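/- **Language.** Types are $\tau,\sigma ::= \mathbf{real} \mid \tau_1 * \cdots * \tau_n \mid \sigma\to\tau \mid \{C_1\,\tau_1 \mid \cdots \mid C_n\,\tau_n\} \mid \mathbf{list}(\tau)$ with $n\ge 0$. The well-typed terms $\Gamma\vdash t:\tau$ are those of the simply typed $\lambda$-calculus with variables, constants $\underline c:\mathbf{real}$ ($c\in\mathbb R$), $t+u$, $t*u$ and $\varsigma(t)$ on $\mathbf{real}$, tuples $\langle t_1,\dots,t_n\rangle$ and tuple matching, $\lambda$-abstraction and application, variant constructors $C_i\,t$ and case distinction, $[\,]$, $t::u$ and $\mathrm{fold}\,(x_1,x_2).t\ \mathrm{over}\ u\ \mathrm{from}\ v$ on lists. A type is *first order* (ground) if it contains no function type, and a context is first order if all its types are. **Semantics.** Types denote diffeological spaces: $[\![\mathbf{real}]\!]=\mathbb R$, products denote products, $[\![\sigma\to\tau]\!]$ is the space of smooth maps with the functional diffeology, variants denote disjoint unions, and $[\![\mathbf{list}(\tau)]\!]=\biguplus_{m\ge 0}[\![\tau]\!]^m$. A context denotes the product of its types, and a term $\Gamma\vdash t:\tau$ denotes a smooth map $[\![t]\!]:[\![\Gamma]\!]\to[\![\tau]\!]$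 in the usual way, with $\varsigma(x)=1/(1+e^{-x})$. **Translations.** Fix $k\ge 0$. The type translations $D^k$ and $D_{rev}^k$ commute with all type formers other than $\mathbf{real}$, and $D^k(\mathbf{real})=\mathbf{real}*\mathbf{real}^k$, $D_{rev}^k(\mathbf{real})=\mathbf{real}*(\mathbf{real}\to\mathbf{real}^k)$. On terms, $D_{rev}^k$ commutes with all term formers except - $D_{rev}^k(\underline c)=\langle\underline c,\lambda z.\langle\underline 0,\dots,\underline 0\rangle\rangle$, - $D_{rev}^k(t+u)=\langle x+y,\ \lambda z.\,x'z+y'z\rangle$, - $D_{rev}^k(t*u)=\langle x*y,\ \lambda z.\,x'(y*z)+y'(x*z)\rangle$, - $D_{rev}^k(\varsigma(t))=\mathrm{let}\ y=\varsigma(x)\ \mathrm{in}\ \langle y,\ \lambda z.\,x'(y*(1-y)*z)\rangle$, where $D_{rev}^k(t)$ and $D_{rev}^k(u)$ are matched with $\langle x,x'\rangle$ and $\langle y,y'\rangle$ (in the last line $D_{rev}^k(t)$ is matched with $\langle x,x'\rangle$). For first order $\tau$ the closed terms $\mathrm{lamR}_\tau:D^k\tau\to D_{rev}^k\tau$ and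 $\mathrm{evR}_\tau:D_{rev}^k\tau\to D^k\tau$ act componentwise on products, variants and lists, and at $\mathbf{real}$ they are $\langle x,\langle x_1',\dots,x_k'\rangle\rangle\mapsto\langle x,\lambda y.\langle x_1'*y,\dots,x_k'*y\rangle\rangle$ and $\langle x,x'\rangle\mapsto\langle x,x'\,\underline 1\rangle$. For $\Gamma\vdash t:\tau$ with $\Gamma$ and $\tau$ first order, $\mathrm{lamR}_\Gamma;D_{rev}^k(t);\mathrm{evR}_\tau$ is the term $D^k\Gamma\vdash\mathrm{evR}_\tau\big(D_{rev}^k(t)[\mathrm{lamR}_\sigma\,x/x]_{(x:\sigma)\in\Gamma}\big):D^k\tau$. **Tangent functor.** For $M=[\![\tau]\!]$ or $[\![\Gamma]\!]$ with $\tau$, $\Gamma$ first order (a manifold, with components of possibly different dimensions), $T_xM$ is the set of smooth curves $\gamma:\mathbb R\to M$ with $\gamma(0)=x$, where $\gamma_1\sim\gamma_2$ iff $(f\circ\gamma_1)'(0)=(f\circ\gamma_2)'(0)$ for all smooth $f:M\to\mathbb R$. $T^kM$ is the $k$-fold fibre product over $M$ of the tangent bundle $TM$ with itself; its points are $(x,(v_1,\dots,v_k))$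 with $v_j\in T_xM$. For smooth $f:M\to N$, $T^kf(x,([\gamma_j])_j)=(f(x),([f\circ\gamma_j])_j)$. The canonical maps $\phi_\tau:[\![D^k\tau]\!]\to T^k[\![\tau]\!]$ and $\phi_\Gamma:[\![D^k\Gamma]\!]\to T^k[\![\Gamma]\!]$ are defined by induction, by $\phi_{\mathbf{real}}(x,x')=(x,([s\mapsto x+x_j's])_j)$ at $\mathbf{real}$, and through the canonical isomorphisms $\prod_iT^kM_i\cong T^k\prod_iM_i$ and $\biguplus_iT^kM_i\cong T^k\biguplus_iM_i$ at the other types and at contexts. **Theorem (semantic correctness of $D_{rev}^k$).** Let $k\ge 0$, let $\tau$ be a first order type, $\Gamma$ a first order context and $\Gamma\vdash t:\tau$ a term (which may use function types internally). Then $\phi_\Gamma$ and $\phi_\tau$ are isomorphisms (diffeomorphisms), and $$\phi_\tau\circ[\![\mathrm{lamR}_\Gamma;D_{rev}^k(t);\mathrm{evR}_\tau]\!]\;=\;T^k[\![t]\!]\circ\phi_\Gamma .$$ -/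

import Mathlib

open Diffeology
open scoped ContDiff

noncomputable section

namespace RevAD

/-! ## Diffeological spaces

Diffeologies are Mathlib's `DiffeologicalSpace`, whose plots are parametrised by the spaces `ℝⁿ`.
This gives the same category as plots parametrised by open subsets of the `ℝⁿ`. -/

/-- The diffeology on `X` induced by a map into a diffeological space. -/
@[reducible]
def induced {X Y : Type} (f : X → Y) (d : DiffeologicalSpace Y) : DiffeologicalSpace X where
  plots n := {p | IsPlot (f ∘ p)}
  constant_plots x := DiffeologicalSpace.constant_plots (f x)
  plot_reparam hp hf := DiffeologicalSpace.plot_reparam hp hf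
  locality {_ p} hp := DiffeologicalSpace.locality (p := f ∘ p) fun x ↦ by
    obtain ⟨u, hu, hxu, h⟩ := hp x
    exact ⟨u, hu, hxu, fun hfu hf ↦ h hfu hf⟩

theorem isPlot_induced {X Y : Type} {f : X → Y} {d : DiffeologicalSpace Y} {n : ℕ}
    {p : EuclideanSpace ℝ (Fin n) → X} : @IsPlot X (induced f d) n p ↔ IsPlot (f ∘ p) :=
  Iff.rfl

/-- A diffeological space, bundled. -/
structure DiffSp where
  carrier : Type
  str : DiffeologicalSpace carrier

instance : CoeSort DiffSp Type := ⟨DiffSp.carrier⟩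

instance (X : DiffSp) : DiffeologicalSpace X := X.str

/-- Smooth maps between diffeological spaces. -/
@[ext]
structure Hom (X Y : DiffSp) where
  toFun : X → Y
  smooth : DSmooth toFun

instance (X Y : DiffSp) : CoeFun (Hom X Y) (fun _ ↦ X → Y) := ⟨Hom.toFun⟩

namespace DiffSp

/-- The real line with its usual diffeology. -/
def real : DiffSp := ⟨ℝ, inferInstance⟩

/-- Euclidean space with its usual diffeology. -/
def euc (n : ℕ) : DiffSp := ⟨EuclideanSpace ℝ (Fin n), inferInstance⟩

/-- The one-point space. -/
def unit : DiffSp := ⟨Unit, ⊤⟩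

/-- Binary products, with the product diffeology. -/
def prod (X Y : DiffSp) : DiffSp := ⟨X × Y, induced Prod.fst X.str ⊓ induced Prod.snd Y.str⟩

/-- Products of families, with the product diffeology. -/
def pi {ι : Type} (X : ι → DiffSp) : DiffSp :=
  ⟨∀ i, X i, ⨅ i, induced (fun x : (∀ i, X i) ↦ x i) (X i).str⟩

theorem isPlot_unit {n : ℕ} (p : EuclideanSpace ℝ (Fin n) → unit) : IsPlot p :=
  DiffeologicalSpace.constant_plots (X := unit) ()

theorem isPlot_prod {X Y : DiffSp} {n : ℕ} {p : EuclideanSpace ℝ (Fin n) → prod X Y} :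
    IsPlot p ↔ IsPlot (fun u ↦ (p u).1) ∧ IsPlot (fun u ↦ (p u).2) :=
  DiffeologicalSpace.isPlot_inf_iff

theorem isPlot_pi {ι : Type} {X : ι → DiffSp} {n : ℕ} {p : EuclideanSpace ℝ (Fin n) → pi X} :
    IsPlot p ↔ ∀ i, IsPlot (fun u ↦ p u i) :=
  DiffeologicalSpace.isPlot_iInf_iff

theorem isPlot_real {n : ℕ} {p : EuclideanSpace ℝ (Fin n) → ℝ} :
    IsPlot (X := real) p ↔ ContDiff ℝ ∞ p :=
  Iff.rfl

theorem isPlot_euc {m n : ℕ} {p : EuclideanSpace ℝ (Fin n) → EuclideanSpace ℝ (Fin m)} :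
    IsPlot (X := euc m) p ↔ ContDiff ℝ ∞ p :=
  Iff.rfl

/-- Disjoint unions of families. Since `ℝⁿ` is connected, a decomposition of `ℝⁿ` into disjoint
open sets, each mapped smoothly to one summand, is trivial: a plot is a plot of one summand. -/
def sigma {ι : Type} (X : ι → DiffSp) : DiffSp where
  carrier := Σ i, X i
  str :=
    { plots n := {p | ∃ (i : ι) (q : EuclideanSpace ℝ (Fin n) → X i),
        IsPlot q ∧ p = fun u ↦ ⟨i, q u⟩}
      constant_plots := fun x ↦ ⟨x.1, fun _ ↦ x.2, DiffeologicalSpace.constant_plots x.2, rfl⟩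
      plot_reparam := by
        rintro n m p f ⟨i, q, hq, rfl⟩ hf
        exact ⟨i, q ∘ f, DiffeologicalSpace.plot_reparam hq hf, rfl⟩
      locality := by
        intro n p hp
        have hloc : IsLocallyConstant (fun u ↦ (p u).1) := by
          rw [IsLocallyConstant.iff_exists_open]
          intro x
          obtain ⟨u, hu, hxu, h⟩ := hp x
          obtain ⟨ε, hε, hεu⟩ := Metric.isOpen_iff.mp hu x hxu
          have himg : ∀ y, OpenPartialHomeomorph.univBall x ε y ∈ Metric.ball x ε := fun y ↦ by
            have := (OpenPartialHomeomorph.univBall x ε).map_source (x := y) (by simp)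
            rwa [OpenPartialHomeomorph.univBall_target x hε] at this
          obtain ⟨i, q, -, hpq⟩ := h (f := OpenPartialHomeomorph.univBall x ε)
            (fun y ↦ hεu (himg y)) OpenPartialHomeomorph.contDiff_univBall
          have hconst : ∀ y ∈ Metric.ball x ε, (p y).1 = i := fun y hy ↦ by
            have hy' : y ∈ (OpenPartialHomeomorph.univBall x ε).target := by
              rwa [OpenPartialHomeomorph.univBall_target x hε]
            have h1 := congrFun hpq ((OpenPartialHomeomorph.univBall x ε).symm y)
            simp only [Function.comp] at h1
            rw [(OpenPartialHomeomorph.univBall x ε).right_inv hy'] at h1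
            rw [h1]
          refine ⟨Metric.ball x ε, Metric.isOpen_ball, Metric.mem_ball_self hε, fun y hy ↦ ?_⟩
          rw [hconst y hy, hconst x (Metric.mem_ball_self hε)]
        have hfib : ∀ y, ∃ a : X (p 0).1, p y = ⟨(p 0).1, a⟩ := fun y ↦ by
          have h1 : (p y).1 = (p 0).1 := hloc.apply_eq_of_isPreconnected isPreconnected_univ
            (Set.mem_univ y) (Set.mem_univ 0)
          exact ⟨h1 ▸ (p y).2, by
            generalize (p 0).1 = j at h1
            subst h1
            rfl⟩
        choose q hq using hfib
        refine ⟨(p 0).1, q, DiffeologicalSpace.locality fun x ↦ ?_, funext hq⟩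
        obtain ⟨u, hu, hxu, h⟩ := hp x
        refine ⟨u, hu, hxu, fun {m f} hfu hf ↦ ?_⟩
        obtain ⟨i, r, hr, hpr⟩ := h hfu hf
        have hir : ∀ z, (⟨(p 0).1, q (f z)⟩ : Σ i, X i) = ⟨i, r z⟩ := fun z ↦ by
          rw [← hq]
          exact congrFun hpr z
        have hi : (p 0).1 = i := congrArg Sigma.fst (hir 0)
        generalize (p 0).1 = j at hi q hir
        subst hi
        have : q ∘ f = r := funext fun z ↦ eq_of_heq (Sigma.mk.inj (hir z)).2
        rw [this]
        exact hr }

/-- Spaces of smooth maps, with the functional diffeology. -/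
def exp (X Y : DiffSp) : DiffSp where
  carrier := Hom X Y
  str :=
    { plots n := {p | DSmooth (fun z : prod (euc n) X ↦ p z.1 z.2)}
      constant_plots := fun f n q hq ↦ f.smooth n _ (isPlot_prod.1 hq).2
      plot_reparam := fun {n m p f} hp hf l q hq ↦
        hp l (fun z ↦ ((f (q z).1, (q z).2) : prod (euc m) X)) (isPlot_prod.2
          ⟨isPlot_euc.2 (hf.comp (isPlot_euc.1 (isPlot_prod.1 hq).1)), (isPlot_prod.1 hq).2⟩)
      locality := fun {n p} hp l q hq ↦ DiffeologicalSpace.locality fun z ↦ by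
        obtain ⟨u, hu, hzu, h⟩ := hp (q z).1
        have hg := isPlot_euc.1 (isPlot_prod.1 hq).1
        refine ⟨_, hu.preimage hg.continuous, hzu, fun {m f} hfu hf ↦ ?_⟩
        exact h (f := fun w ↦ (q (f w)).1) hfu (hg.comp hf) m
          (fun w ↦ ((w, (q (f w)).2) : prod (euc m) X))
          (isPlot_prod.2 ⟨isPlot_id, DiffeologicalSpace.plot_reparam (isPlot_prod.1 hq).2 hf⟩) }

/-- Lists over `X`, as the disjoint union of all finite powers of `X`. -/
def list (X : DiffSp) : DiffSp := sigma fun m : ℕ ↦ pi fun _ : Fin m ↦ X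

end DiffSp

namespace Hom

variable {E X Y Z : DiffSp}

def id (X : DiffSp) : Hom X X := ⟨fun x ↦ x, fun _ _ hp ↦ hp⟩

def const (c : Y) : Hom X Y := ⟨fun _ ↦ c, fun _ _ _ ↦ DiffeologicalSpace.constant_plots c⟩

def comp (g : Hom Y Z) (f : Hom X Y) : Hom X Z :=
  ⟨fun x ↦ g (f x), fun n p hp ↦ g.smooth n _ (f.smooth n p hp)⟩

def toUnit : Hom X DiffSp.unit := ⟨fun _ ↦ (), fun _ _ _ ↦ DiffSp.isPlot_unit _⟩

def fst : Hom (DiffSp.prod X Y) X := ⟨fun z ↦ z.1, fun _ _ hp ↦ (DiffSp.isPlot_prod.1 hp).1⟩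

def snd : Hom (DiffSp.prod X Y) Y := ⟨fun z ↦ z.2, fun _ _ hp ↦ (DiffSp.isPlot_prod.1 hp).2⟩

def pair (f : Hom E X) (g : Hom E Y) : Hom E (DiffSp.prod X Y) :=
  ⟨fun e ↦ (f e, g e), fun n p hp ↦ DiffSp.isPlot_prod.2 ⟨f.smooth n p hp, g.smooth n p hp⟩⟩

def piProj {ι : Type} {X : ι → DiffSp} (i : ι) : Hom (DiffSp.pi X) (X i) :=
  ⟨fun x ↦ x i, fun _ _ hp ↦ DiffSp.isPlot_pi.1 hp i⟩

def piLift {ι : Type} {X : ι → DiffSp} (f : ∀ i, Hom E (X i)) : Hom E (DiffSp.pi X) :=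
  ⟨fun e i ↦ f i e, fun n p hp ↦ DiffSp.isPlot_pi.2 fun i ↦ (f i).smooth n p hp⟩

def inj {ι : Type} {X : ι → DiffSp} (i : ι) : Hom (X i) (DiffSp.sigma X) :=
  ⟨fun x ↦ ⟨i, x⟩, fun _ p hp ↦ ⟨i, p, hp, rfl⟩⟩

/-- Case distinction over a disjoint union, with parameters in `E`. -/
def case {ι : Type} {X : ι → DiffSp} (f : ∀ i, Hom (DiffSp.prod (X i) E) Y) :
    Hom (DiffSp.prod (DiffSp.sigma X) E) Y where
  toFun z := f z.1.1 (z.1.2, z.2)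
  smooth n p hp := by
    obtain ⟨⟨i, q, hq, hpq⟩, h2⟩ := DiffSp.isPlot_prod.1 hp
    have := (f i).smooth n (fun u ↦ (q u, (p u).2)) (DiffSp.isPlot_prod.2 ⟨hq, h2⟩)
    convert this using 1
    funext u
    have key : ∀ (s : DiffSp.sigma X) (e : E), s = ⟨i, q u⟩ → f s.1 (s.2, e) = f i (q u, e) := by
      rintro _ e rfl
      rfl
    exact key _ _ (congrFun hpq u)

def curry (f : Hom (DiffSp.prod X E) Y) : Hom E (DiffSp.exp X Y) where
  toFun e := ⟨fun x ↦ f (x, e), fun n p hp ↦ f.smooth n (fun u ↦ (p u, e))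
    (DiffSp.isPlot_prod.2 ⟨hp, DiffeologicalSpace.constant_plots e⟩)⟩
  smooth _ p hp m q hq := f.smooth m (fun z ↦ ((q z).2, p (q z).1))
    (DiffSp.isPlot_prod.2 ⟨(DiffSp.isPlot_prod.1 hq).2,
      DiffeologicalSpace.plot_reparam hp (DiffSp.isPlot_euc.1 (DiffSp.isPlot_prod.1 hq).1)⟩)

def app (f : Hom E (DiffSp.exp X Y)) (g : Hom E X) : Hom E Y where
  toFun e := (f e).toFun (g e)
  smooth n p hp := f.smooth n p hp n (fun u ↦ ((u, g (p u)) : DiffSp.prod (DiffSp.euc n) X))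
    (DiffSp.isPlot_prod.2 ⟨isPlot_id, g.smooth n p hp⟩)

def nil : Hom E (DiffSp.list X) := const ⟨0, fun i ↦ i.elim0⟩

def cons (f : Hom E X) (g : Hom E (DiffSp.list X)) : Hom E (DiffSp.list X) where
  toFun e := ⟨(g e).1 + 1, Fin.cons (f e) (g e).2⟩
  smooth n p hp := by
    obtain ⟨m, q, hq, hpq⟩ := g.smooth n p hp
    refine ⟨m + 1, fun u ↦ Fin.cons (f (p u)) (q u), DiffSp.isPlot_pi.2 fun i ↦ ?_, ?_⟩
    · refine Fin.cases ?_ (fun j ↦ ?_) i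
      · exact f.smooth n p hp
      · exact DiffSp.isPlot_pi.1 hq j
    · funext u
      have hu : g (p u) = ⟨m, q u⟩ := congrFun hpq u
      simp only [Function.comp]
      rw [hu]

/-- The right fold of a list `v` of length `m`, at the parameter `e`. -/
def foldAux (step : Hom (DiffSp.prod Y (DiffSp.prod X E)) Y) (init : Hom E Y) (e : E) :
    (m : ℕ) → (Fin m → X) → Y
  | 0, _ => init e
  | m + 1, v => step (foldAux step init e m (fun i ↦ v i.succ), (v 0, e))

theorem foldAux_smooth (step : Hom (DiffSp.prod Y (DiffSp.prod X E)) Y) (init : Hom E Y) {n : ℕ}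
    (p : EuclideanSpace ℝ (Fin n) → E) (hp : IsPlot p) (m : ℕ)
    (q : EuclideanSpace ℝ (Fin n) → Fin m → X) (hq : ∀ i, IsPlot (fun u ↦ q u i)) :
    IsPlot (fun u ↦ foldAux step init (p u) m (q u)) := by
  induction m with
  | zero => exact init.smooth n p hp
  | succ m ih =>
    exact step.smooth n _ (DiffSp.isPlot_prod.2
      ⟨ih (fun u i ↦ q u i.succ) (fun i ↦ hq i.succ), DiffSp.isPlot_prod.2 ⟨hq 0, hp⟩⟩)

def fold (step : Hom (DiffSp.prod Y (DiffSp.prod X E)) Y) (l : Hom E (DiffSp.list X))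
    (init : Hom E Y) : Hom E Y where
  toFun e := foldAux step init e (l e).1 (l e).2
  smooth n p hp := by
    obtain ⟨m, q, hq, hpq⟩ := l.smooth n p hp
    convert foldAux_smooth step init p hp m q (DiffSp.isPlot_pi.1 hq) using 1
    funext u
    have hu : l (p u) = ⟨m, q u⟩ := congrFun hpq u
    simp only [Function.comp]
    rw [hu]

def ofContDiff (f : ℝ → ℝ) (hf : ContDiff ℝ ∞ f) : Hom DiffSp.real DiffSp.real :=
  ⟨f, fun _ _ hp ↦ DiffSp.isPlot_real.2 (hf.comp (DiffSp.isPlot_real.1 hp))⟩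

def add (f g : Hom E DiffSp.real) : Hom E DiffSp.real :=
  ⟨fun e ↦ HAdd.hAdd (α := ℝ) (β := ℝ) (f e) (g e), fun n p hp ↦ DiffSp.isPlot_real.2
    ((DiffSp.isPlot_real.1 (f.smooth n p hp)).add (DiffSp.isPlot_real.1 (g.smooth n p hp)))⟩

def mul (f g : Hom E DiffSp.real) : Hom E DiffSp.real :=
  ⟨fun e ↦ HMul.hMul (α := ℝ) (β := ℝ) (f e) (g e), fun n p hp ↦ DiffSp.isPlot_real.2
    ((DiffSp.isPlot_real.1 (f.smooth n p hp)).mul (DiffSp.isPlot_real.1 (g.smooth n p hp)))⟩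

/-- The sigmoid function `x ↦ 1 / (1 + e⁻ˣ)`. -/
def sigmoid : Hom DiffSp.real DiffSp.real :=
  ofContDiff (fun x ↦ 1 / (1 + Real.exp (-x))) (by
    refine contDiff_const.div (contDiff_const.add (Real.contDiff_exp.comp contDiff_neg)) ?_
    intro x
    positivity)

end Hom

/-! ## The language -/

/-- Types: reals, finite products, functions, finite variants (the constructors of a variant are
numbered by `Fin n`), and lists. -/
inductive Ty : Type
  | real : Ty
  | prod (n : ℕ) (σ : Fin n → Ty) : Ty
  | fn (σ τ : Ty) : Ty
  | variant (n : ℕ) (σ : Fin n → Ty) : Ty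
  | list (σ : Ty) : Ty

namespace Ty

/-- Binary products. -/
def pair (σ τ : Ty) : Ty := prod 2 ![σ, τ]

/-- The type `realᵏ`. -/
def vec (k : ℕ) : Ty := prod k fun _ ↦ real

/-- First order types: those built without function types. -/
def FirstOrder : Ty → Prop
  | real => True
  | prod _ σ => ∀ i, (σ i).FirstOrder
  | fn _ _ => False
  | variant _ σ => ∀ i, (σ i).FirstOrder
  | list σ => σ.FirstOrder

/-- The forward translation of types with `k` tangents. -/
def D (k : ℕ) : Ty → Ty
  | real => pair real (vec k)
  | prod n σ => prod n fun i ↦ (σ i).D k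
  | fn σ τ => fn (σ.D k) (τ.D k)
  | variant n σ => variant n fun i ↦ (σ i).D k
  | list σ => list (σ.D k)

/-- The continuation-based translation of types, with answer type `realᵏ`. -/
def Drev (k : ℕ) : Ty → Ty
  | real => pair real (fn real (vec k))
  | prod n σ => prod n fun i ↦ (σ i).Drev k
  | fn σ τ => fn (σ.Drev k) (τ.Drev k)
  | variant n σ => variant n fun i ↦ (σ i).Drev k
  | list σ => list (σ.Drev k)

end Ty

/-- Contexts: lists of the types of the variables, the most recently bound variable first. -/
abbrev Ctx := List Ty

/-- A context is first order if all its types are. -/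
def Ctx.FirstOrder (Γ : Ctx) : Prop := ∀ τ ∈ Γ, τ.FirstOrder

/-- `Γ` extended by `n` variables of types `σ 0, …, σ (n - 1)`. -/
def Ctx.ext (Γ : Ctx) : (n : ℕ) → (Fin n → Ty) → Ctx
  | 0, _ => Γ
  | n + 1, σ => σ 0 :: Ctx.ext Γ n fun i ↦ σ i.succ

theorem Ctx.map_ext (f : Ty → Ty) (Γ : Ctx) (n : ℕ) (σ : Fin n → Ty) :
    List.map f (Ctx.ext Γ n σ) = Ctx.ext (List.map f Γ) n fun i ↦ f (σ i) := by
  induction n with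
  | zero => rfl
  | succ n ih => simp only [Ctx.ext, List.map_cons, ih]

/-- Variables of type `τ` in a context, as de Bruijn indices. -/
inductive Var : Ctx → Ty → Type
  | z {Γ : Ctx} {τ : Ty} : Var (τ :: Γ) τ
  | s {Γ : Ctx} {σ τ : Ty} (x : Var Γ τ) : Var (σ :: Γ) τ

namespace Var

/-- The `i`-th of the `n` variables bound in `Γ.ext n σ`. -/
def bound {Γ : Ctx} : (n : ℕ) → (σ : Fin n → Ty) → (i : Fin n) → Var (Γ.ext n σ) (σ i)
  | 0, _ => fun i ↦ i.elim0
  | n + 1, σ => Fin.cases z fun i ↦ s (bound n (fun i ↦ σ i.succ) i)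

/-- A variable of `Γ`, seen in `Γ.ext n σ`. -/
def weaken {Γ : Ctx} {τ : Ty} : (n : ℕ) → (σ : Fin n → Ty) → Var Γ τ → Var (Γ.ext n σ) τ
  | 0, _, x => x
  | n + 1, σ, x => s (weaken n (fun i ↦ σ i.succ) x)

/-- The variable at the same position of the context translated by `f`. -/
def map (f : Ty → Ty) {Γ : Ctx} {τ : Ty} : Var Γ τ → Var (List.map f Γ) (f τ)
  | z => z
  | s x => s (x.map f)

end Var

/-- Well-typed terms `Γ ⊢ t : τ`.
* `letTuple t u` is the pattern match `case t of ⟨x₁, …, xₙ⟩ → u`;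
* `case t u` is the match `case t of {C₁ x₁ → u₁ | ⋯ | Cₙ xₙ → uₙ}`;
* `fold t u v` is `fold (x₁, x₂). t over u from v`, where in `t` the variable `x₁` (of index one)
  is the head of the list and `x₂` (of index zero) is the result for its tail. -/
inductive Tm : Ctx → Ty → Type
  | var {Γ : Ctx} {τ : Ty} (x : Var Γ τ) : Tm Γ τ
  | cst {Γ : Ctx} (c : ℝ) : Tm Γ Ty.real
  | add {Γ : Ctx} (t u : Tm Γ Ty.real) : Tm Γ Ty.real
  | mul {Γ : Ctx} (t u : Tm Γ Ty.real) : Tm Γ Ty.real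
  | sigmoid {Γ : Ctx} (t : Tm Γ Ty.real) : Tm Γ Ty.real
  | tuple {Γ : Ctx} {n : ℕ} {σ : Fin n → Ty} (t : ∀ i, Tm Γ (σ i)) : Tm Γ (Ty.prod n σ)
  | letTuple {Γ : Ctx} {n : ℕ} {σ : Fin n → Ty} {τ : Ty} (t : Tm Γ (Ty.prod n σ))
      (u : Tm (Γ.ext n σ) τ) : Tm Γ τ
  | lam {Γ : Ctx} {σ τ : Ty} (t : Tm (σ :: Γ) τ) : Tm Γ (Ty.fn σ τ)
  | app {Γ : Ctx} {σ τ : Ty} (t : Tm Γ (Ty.fn σ τ)) (u : Tm Γ σ) : Tm Γ τ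
  | inj {Γ : Ctx} {n : ℕ} {σ : Fin n → Ty} (i : Fin n) (t : Tm Γ (σ i)) : Tm Γ (Ty.variant n σ)
  | case {Γ : Ctx} {n : ℕ} {σ : Fin n → Ty} {τ : Ty} (t : Tm Γ (Ty.variant n σ))
      (u : ∀ i, Tm (σ i :: Γ) τ) : Tm Γ τ
  | nil {Γ : Ctx} {σ : Ty} : Tm Γ (Ty.list σ)
  | cons {Γ : Ctx} {σ : Ty} (t : Tm Γ σ) (u : Tm Γ (Ty.list σ)) : Tm Γ (Ty.list σ)
  | fold {Γ : Ctx} {σ τ : Ty} (t : Tm (τ :: σ :: Γ) τ) (u : Tm Γ (Ty.list σ)) (v : Tm Γ τ) :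
      Tm Γ τ

/-! ### Renaming and substitution -/

/-- Renamings of the variables of `Γ` by variables of `Δ`. -/
def Ren (Γ Δ : Ctx) : Type := ∀ ⦃τ : Ty⦄, Var Γ τ → Var Δ τ

def Ren.lift {Γ Δ : Ctx} (r : Ren Γ Δ) (σ : Ty) : Ren (σ :: Γ) (σ :: Δ)
  | _, .z => .z
  | _, .s x => .s (r x)

def Ren.liftN {Γ Δ : Ctx} (r : Ren Γ Δ) : (n : ℕ) → (σ : Fin n → Ty) →
    Ren (Γ.ext n σ) (Δ.ext n σ)
  | 0, _ => r
  | n + 1, σ => Ren.lift (r.liftN n fun i ↦ σ i.succ) (σ 0)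

def Tm.rename : {Γ : Ctx} → {τ : Ty} → Tm Γ τ → {Δ : Ctx} → Ren Γ Δ → Tm Δ τ
  | _, _, .var x, _, r => .var (r x)
  | _, _, .cst c, _, _ => .cst c
  | _, _, .add t u, _, r => .add (t.rename r) (u.rename r)
  | _, _, .mul t u, _, r => .mul (t.rename r) (u.rename r)
  | _, _, .sigmoid t, _, r => .sigmoid (t.rename r)
  | _, _, .tuple t, _, r => .tuple fun i ↦ (t i).rename r
  | _, _, .letTuple t u, _, r => .letTuple (t.rename r) (u.rename (r.liftN _ _))
  | _, _, .lam t, _, r => .lam (t.rename (r.lift _))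
  | _, _, .app t u, _, r => .app (t.rename r) (u.rename r)
  | _, _, .inj i t, _, r => .inj i (t.rename r)
  | _, _, .case t u, _, r => .case (t.rename r) fun i ↦ (u i).rename (r.lift _)
  | _, _, .nil, _, _ => .nil
  | _, _, .cons t u, _, r => .cons (t.rename r) (u.rename r)
  | _, _, .fold t u v, _, r => .fold (t.rename ((r.lift _).lift _)) (u.rename r) (v.rename r)

/-- Weakening by one variable. -/
def Tm.wk {Γ : Ctx} {σ τ : Ty} (t : Tm Γ τ) : Tm (σ :: Γ) τ := t.rename fun _ x ↦ .s x

/-- Weakening by `n` variables. -/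
def Tm.wkN {Γ : Ctx} {τ : Ty} (t : Tm Γ τ) (n : ℕ) (σ : Fin n → Ty) : Tm (Γ.ext n σ) τ :=
  t.rename fun _ x ↦ x.weaken n σ

/-- Simultaneous substitutions for the variables of `Γ` by terms over `Δ`. -/
def Sub (Γ Δ : Ctx) : Type := ∀ ⦃τ : Ty⦄, Var Γ τ → Tm Δ τ

def Sub.lift {Γ Δ : Ctx} (θ : Sub Γ Δ) (σ : Ty) : Sub (σ :: Γ) (σ :: Δ)
  | _, .z => .var .z
  | _, .s x => (θ x).wk

def Sub.liftN {Γ Δ : Ctx} (θ : Sub Γ Δ) : (n : ℕ) → (σ : Fin n → Ty) →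
    Sub (Γ.ext n σ) (Δ.ext n σ)
  | 0, _ => θ
  | n + 1, σ => Sub.lift (θ.liftN n fun i ↦ σ i.succ) (σ 0)

def Tm.subst : {Γ : Ctx} → {τ : Ty} → Tm Γ τ → {Δ : Ctx} → Sub Γ Δ → Tm Δ τ
  | _, _, .var x, _, θ => θ x
  | _, _, .cst c, _, _ => .cst c
  | _, _, .add t u, _, θ => .add (t.subst θ) (u.subst θ)
  | _, _, .mul t u, _, θ => .mul (t.subst θ) (u.subst θ)
  | _, _, .sigmoid t, _, θ => .sigmoid (t.subst θ)
  | _, _, .tuple t, _, θ => .tuple fun i ↦ (t i).subst θ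
  | _, _, .letTuple t u, _, θ => .letTuple (t.subst θ) (u.subst (θ.liftN _ _))
  | _, _, .lam t, _, θ => .lam (t.subst (θ.lift _))
  | _, _, .app t u, _, θ => .app (t.subst θ) (u.subst θ)
  | _, _, .inj i t, _, θ => .inj i (t.subst θ)
  | _, _, .case t u, _, θ => .case (t.subst θ) fun i ↦ (u i).subst (θ.lift _)
  | _, _, .nil, _, _ => .nil
  | _, _, .cons t u, _, θ => .cons (t.subst θ) (u.subst θ)
  | _, _, .fold t u v, _, θ => .fold (t.subst ((θ.lift _).lift _)) (u.subst θ) (v.subst θ)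

/-! ### Syntactic sugar -/

namespace Tm

/-- Pairs `⟨t, u⟩`. -/
def pair {Γ : Ctx} {σ τ : Ty} (t : Tm Γ σ) (u : Tm Γ τ) : Tm Γ (Ty.pair σ τ) :=
  .tuple (σ := ![σ, τ]) (Fin.cases t (Fin.cases u fun i ↦ i.elim0))

/-- `case t of ⟨x, y⟩ → u`; in `u`, the variable `x` has index zero and `y` has index one. -/
def letPair {Γ : Ctx} {σ σ' τ : Ty} (t : Tm Γ (Ty.pair σ σ')) (u : Tm (σ :: σ' :: Γ) τ) :
    Tm Γ τ :=
  .letTuple (σ := ![σ, σ']) t u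

/-- `let x = t in u`. -/
def letIn {Γ : Ctx} {σ τ : Ty} (t : Tm Γ σ) (u : Tm (σ :: Γ) τ) : Tm Γ τ := .app (.lam u) t

/-- `t - u`, that is `t + (-1) * u`. -/
def sub {Γ : Ctx} (t u : Tm Γ Ty.real) : Tm Γ Ty.real := .add t (.mul (.cst (-1)) u)

/-- Addition of vectors: `case t of ⟨x₁, …, xₖ⟩ → case u of ⟨y₁, …, yₖ⟩ → ⟨x₁ + y₁, …, xₖ + yₖ⟩`. -/
def addVec {Γ : Ctx} {k : ℕ} (t u : Tm Γ (Ty.vec k)) : Tm Γ (Ty.vec k) :=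
  .letTuple t <| .letTuple (u.wkN k _) <|
    .tuple fun i ↦ .add (.var ((Var.bound k _ i).weaken k _)) (.var (Var.bound k _ i))

/-- Transport of a term along an equality of contexts. -/
def castCtx {Γ Δ : Ctx} {τ : Ty} (h : Γ = Δ) (t : Tm Γ τ) : Tm Δ τ := h ▸ t

/-- The variable of index zero, one, two, three. -/
def v0 {Γ : Ctx} {a : Ty} : Tm (a :: Γ) a := .var .z
def v1 {Γ : Ctx} {a b : Ty} : Tm (b :: a :: Γ) a := .var (.s .z)
def v2 {Γ : Ctx} {a b c : Ty} : Tm (c :: b :: a :: Γ) a := .var (.s (.s .z))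
def v3 {Γ : Ctx} {a b c d : Ty} : Tm (d :: c :: b :: a :: Γ) a := .var (.s (.s (.s .z)))
def v4 {Γ : Ctx} {a b c d e : Ty} : Tm (e :: d :: c :: b :: a :: Γ) a :=
  .var (.s (.s (.s (.s .z))))

/-! ### The continuation-based translation of terms -/

/-- `⟨c, λ z. ⟨0, …, 0⟩⟩`. -/
def cstRev (k : ℕ) {Γ : Ctx} (c : ℝ) : Tm Γ (Ty.real.Drev k) :=
  pair (.cst c) (.lam (.tuple fun _ ↦ .cst 0))

/-- `case t of ⟨x, x'⟩ → case u of ⟨y, y'⟩ → ⟨x + y, λ z. x' z + y' z⟩`.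
Under the innermost binder the indices are `z = 0`, `y = 1`, `y' = 2`, `x = 3`, `x' = 4`. -/
def addRev (k : ℕ) {Γ : Ctx} (t u : Tm Γ (Ty.real.Drev k)) : Tm Γ (Ty.real.Drev k) :=
  letPair t <| letPair u.wk.wk <|
    pair (.add v2 v0) (.lam (addVec (.app v4 v0) (.app v2 v0)))

/-- `case t of ⟨x, x'⟩ → case u of ⟨y, y'⟩ → ⟨x * y, λ z. x' (y * z) + y' (x * z)⟩`. -/
def mulRev (k : ℕ) {Γ : Ctx} (t u : Tm Γ (Ty.real.Drev k)) : Tm Γ (Ty.real.Drev k) :=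
  letPair t <| letPair u.wk.wk <|
    pair (.mul v2 v0) (.lam (addVec (.app v4 (.mul v1 v0)) (.app v2 (.mul v3 v0))))

/-- `case t of ⟨x, x'⟩ → let y = ς(x) in ⟨y, λ z. x' (y * (1 - y) * z)⟩`.
Under the innermost binder the indices are `z = 0`, `y = 1`, `x = 2`, `x' = 3`. -/
def sigmoidRev (k : ℕ) {Γ : Ctx} (t : Tm Γ (Ty.real.Drev k)) : Tm Γ (Ty.real.Drev k) :=
  letPair t <| letIn (.sigmoid v0) <|
    pair v0 (.lam (.app v3 (.mul (.mul v1 (sub (.cst 1) v1)) v0)))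

/-- The continuation-based translation of terms. It preserves all type and term formers other than
the reals and their operations. -/
def Drev (k : ℕ) : {Γ : Ctx} → {τ : Ty} → Tm Γ τ → Tm (List.map (Ty.Drev k) Γ) (τ.Drev k)
  | _, _, .var x => .var (x.map (Ty.Drev k))
  | _, _, .cst c => cstRev k c
  | _, _, .add t u => addRev k (t.Drev k) (u.Drev k)
  | _, _, .mul t u => mulRev k (t.Drev k) (u.Drev k)
  | _, _, .sigmoid t => sigmoidRev k (t.Drev k)
  | _, _, .tuple t => .tuple fun i ↦ (t i).Drev k
  | _, _, .letTuple t u => .letTuple (t.Drev k) (castCtx (Ctx.map_ext _ _ _ _) (u.Drev k))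
  | _, _, .lam t => .lam (t.Drev k)
  | _, _, .app t u => .app (t.Drev k) (u.Drev k)
  | _, _, .inj i t => .inj i (t.Drev k)
  | _, _, .case t u => .case (t.Drev k) fun i ↦ (u i).Drev k
  | _, _, .nil => .nil
  | _, _, .cons t u => .cons (t.Drev k) (u.Drev k)
  | _, _, .fold t u v => .fold (t.Drev k) (u.Drev k) (v.Drev k)

/-- The terms `lamR_τ : D τ → Drev τ` for first order `τ`, encoding tangent vectors as closures:
at the reals, `λ z. case z of ⟨x, x'⟩ → case x' of ⟨x'₁, …, x'ₖ⟩ → ⟨x, λ y. ⟨x'₁ * y, …, x'ₖ * y⟩⟩`,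
and componentwise at the other types. -/
def lamR (k : ℕ) {Γ : Ctx} : (τ : Ty) → τ.FirstOrder → Tm Γ (Ty.fn (τ.D k) (τ.Drev k))
  | .real, _ => .lam <| letPair v0 <| .letTuple (σ := fun _ : Fin k ↦ Ty.real) v1 <|
      pair (v0.wkN k _) (.lam (.tuple fun i ↦ .mul (.var (.s (.bound k _ i))) v0))
  | .prod n _, h => .lam <| .letTuple v0 <|
      .tuple fun i ↦ .app (lamR k _ (h i)) (.var (.bound n _ i))
  | .fn _ _, h => h.elim
  | .variant _ _, h => .lam <| .case v0 fun i ↦ .inj i (.app (lamR k _ (h i)) v0)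
  | .list σ, h => .lam <| .fold (.cons (.app (lamR k σ h) v1) v0) v0 .nil

/-- The terms `evR_τ : Drev τ → D τ` for first order `τ`, evaluating the closures: at the reals,
`λ z. case z of ⟨x, x'⟩ → ⟨x, x' 1⟩`, and componentwise at the other types. -/
def evR (k : ℕ) {Γ : Ctx} : (τ : Ty) → τ.FirstOrder → Tm Γ (Ty.fn (τ.Drev k) (τ.D k))
  | .real, _ => .lam <| letPair v0 <| pair v0 (.app v1 (.cst 1))
  | .prod n _, h => .lam <| .letTuple v0 <|
      .tuple fun i ↦ .app (evR k _ (h i)) (.var (.bound n _ i))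
  | .fn _ _, h => h.elim
  | .variant _ _, h => .lam <| .case v0 fun i ↦ .inj i (.app (evR k _ (h i)) v0)
  | .list σ, h => .lam <| .fold (.cons (.app (evR k σ h) v1) v0) v0 .nil

end Tm

/-- `lamR` for a first order context: each variable `x : Drev τ` is replaced by `lamR_τ x`, where
now `x : D τ`. -/
def Sub.lamR (k : ℕ) : (Γ : Ctx) → Γ.FirstOrder →
    Sub (List.map (Ty.Drev k) Γ) (List.map (Ty.D k) Γ)
  | [], _ => fun _ x ↦ nomatch x
  | σ :: Γ, h => fun _ x ↦ match x with
    | .z => .app (Tm.lamR k σ (h σ (by simp))) Tm.v0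
    | .s x => (Sub.lamR k Γ (fun τ hτ ↦ h τ (by simp [hτ])) x).wk

/-- The composite `lamR_Γ ; Drev t ; evR_τ`, that is the term `evR_τ ((Drev t)[lamR_Γ])`. -/
def Tm.revAD (k : ℕ) {Γ : Ctx} {τ : Ty} (hΓ : Γ.FirstOrder) (hτ : τ.FirstOrder) (t : Tm Γ τ) :
    Tm (List.map (Ty.D k) Γ) (τ.D k) :=
  .app (Tm.evR k τ hτ) ((t.Drev k).subst (Sub.lamR k Γ hΓ))

/-! ### Denotational semantics -/

/-- The diffeological space denoted by a type. -/
def Ty.sem : Ty → DiffSp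
  | .real => DiffSp.real
  | .prod _ σ => DiffSp.pi fun i ↦ (σ i).sem
  | .fn σ τ => DiffSp.exp σ.sem τ.sem
  | .variant _ σ => DiffSp.sigma fun i ↦ (σ i).sem
  | .list σ => DiffSp.list σ.sem

/-- The diffeological space denoted by a context: the product of the spaces of its variables. -/
def Ctx.sem : Ctx → DiffSp
  | [] => DiffSp.unit
  | τ :: Γ => DiffSp.prod τ.sem (Ctx.sem Γ)

def Var.sem : {Γ : Ctx} → {τ : Ty} → Var Γ τ → Hom Γ.sem τ.sem
  | _, _, .z => Hom.fst
  | _, _, .s x => Hom.comp x.sem Hom.snd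

/-- The extension of a valuation of `Γ` by the components of a tuple. -/
def Ctx.semExt {E : DiffSp} {Γ : Ctx} (ρ : Hom E Γ.sem) : (n : ℕ) → (σ : Fin n → Ty) →
    (∀ i, Hom E (σ i).sem) → Hom E (Γ.ext n σ).sem
  | 0, _, _ => ρ
  | n + 1, σ, a => Hom.pair (a 0) (Ctx.semExt ρ n (fun i ↦ σ i.succ) fun i ↦ a i.succ)

/-- The smooth map denoted by a term. -/
def Tm.sem : {Γ : Ctx} → {τ : Ty} → Tm Γ τ → Hom Γ.sem τ.sem
  | _, _, .var x => x.sem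
  | _, _, .cst c => Hom.const (Y := DiffSp.real) c
  | _, _, .add t u => Hom.add t.sem u.sem
  | _, _, .mul t u => Hom.mul t.sem u.sem
  | _, _, .sigmoid t => Hom.comp Hom.sigmoid t.sem
  | _, _, .tuple t => Hom.piLift fun i ↦ (t i).sem
  | Γ, _, .letTuple (n := n) (σ := σ) t u => Hom.comp u.sem
      (Ctx.semExt (Hom.id Γ.sem) n σ
        fun i ↦ Hom.comp (Hom.piProj (X := fun i ↦ (σ i).sem) i) t.sem)
  | _, _, .lam t => Hom.curry t.sem
  | _, _, .app t u => Hom.app t.sem u.sem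
  | _, _, .inj (σ := σ) i t => Hom.comp (Hom.inj (X := fun i ↦ (σ i).sem) i) t.sem
  | Γ, _, .case t u => Hom.comp (Hom.case fun i ↦ (u i).sem) (Hom.pair t.sem (Hom.id Γ.sem))
  | _, _, .nil => Hom.nil
  | _, _, .cons t u => Hom.cons t.sem u.sem
  | _, _, .fold t u v => Hom.fold t.sem u.sem v.sem

/-! ## Tangent bundles -/

/-- Smooth curves in `X` based at `x`. -/
def Curve (X : DiffSp) (x : X) : Type := {γ : Hom DiffSp.real X // γ (0 : ℝ) = x}

/-- Two curves based at `x` are tangent if all smooth functions have the same derivative along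
them at time zero. -/
instance Curve.setoid (X : DiffSp) (x : X) : Setoid (Curve X x) where
  r γ₁ γ₂ := ∀ f : Hom X DiffSp.real,
    deriv (F := ℝ) (fun t : ℝ ↦ f (γ₁.1 t)) 0 = deriv (F := ℝ) (fun t : ℝ ↦ f (γ₂.1 t)) 0
  iseqv := ⟨fun _ _ ↦ rfl, fun h f ↦ (h f).symm, fun h h' f ↦ (h f).trans (h' f)⟩

/-- The tangent space of `X` at `x`. -/
def TangentSp (X : DiffSp) (x : X) : Type := Quotient (Curve.setoid X x)

/-- The tangent vector of a smooth curve at time zero. -/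
def velocity {X : DiffSp} (γ : Hom DiffSp.real X) : TangentSp X (γ (0 : ℝ)) :=
  Quotient.mk _ ⟨γ, rfl⟩

/-- The derivative of a smooth map at a point. -/
def TangentSp.map {X Y : DiffSp} (f : Hom X Y) (x : X) : TangentSp X x → TangentSp Y (f x) :=
  Quotient.map (fun γ ↦ ⟨Hom.comp f γ.1, congrArg f.toFun γ.2⟩)
    fun _ _ (h : (Curve.setoid X x).r _ _) g ↦ h (Hom.comp g f)

/-- The tangent bundle. Its diffeology is generated by the smooth families of tangent vectors
`u ↦ (F (u, 0), [t ↦ F (u, t)])`, where `F : ℝⁿ × ℝ → X` is smooth; if `X` is a manifold, then this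
is the diffeology of the usual manifold structure on the tangent bundle. -/
def DiffSp.tangent (X : DiffSp) : DiffSp where
  carrier := Σ x : X, TangentSp X x
  str := DiffeologicalSpace.generateFrom
    {p | ∃ F : Hom (DiffSp.prod (DiffSp.euc p.1) DiffSp.real) X,
      ∀ u : DiffSp.euc p.1, p.2 u =
        ⟨F (u, (0 : ℝ)), velocity (Hom.comp F (Hom.pair (Hom.const u) (Hom.id DiffSp.real)))⟩}

/-- The `k`-fold fibre product of the tangent bundle over `X`: its points are the points of `X`
with `k` tangent vectors, and it has the coarsest diffeology for which the projections to `X` and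
to the tangent bundle are smooth. -/
def DiffSp.tangentPow (k : ℕ) (X : DiffSp) : DiffSp where
  carrier := Σ x : X, (Fin k → TangentSp X x)
  str := induced (fun v ↦ v.1) X.str ⊓
    ⨅ j : Fin k, induced (fun v ↦ (⟨v.1, v.2 j⟩ : X.tangent)) X.tangent.str

/-- The action of the `k`-fold tangent functor on smooth maps. -/
def tangentMap (k : ℕ) {X Y : DiffSp} (f : Hom X Y) (v : X.tangentPow k) : Y.tangentPow k :=
  ⟨f v.1, fun j ↦ TangentSp.map f v.1 (v.2 j)⟩

/-! ### The canonical isomorphisms -/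

/-- The canonical map `∏ᵢ Tᵏ Xᵢ → Tᵏ (∏ᵢ Xᵢ)`, inverse to the map whose components are the
`Tᵏ`-images of the projections: a family of tangent vectors, represented by curves, goes to the
tangent vector of the tuple of these curves. -/
def tangentPi (k : ℕ) {ι : Type} {X : ι → DiffSp} (v : ∀ i, (X i).tangentPow k) :
    (DiffSp.pi X).tangentPow k :=
  ⟨fun i ↦ (v i).1, fun j ↦ Quotient.mk _
    ⟨Hom.piLift fun i ↦ ((v i).2 j).out.1, funext fun i ↦ ((v i).2 j).out.2⟩⟩

/-- The canonical map `Tᵏ X × Tᵏ Y → Tᵏ (X × Y)`. -/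
def tangentProd (k : ℕ) {X Y : DiffSp} (v : X.tangentPow k) (w : Y.tangentPow k) :
    (DiffSp.prod X Y).tangentPow k :=
  ⟨(v.1, w.1), fun j ↦ Quotient.mk _
    ⟨Hom.pair (v.2 j).out.1 (w.2 j).out.1, Prod.ext (v.2 j).out.2 (w.2 j).out.2⟩⟩

theorem tangentMap_tangentPi (k : ℕ) {ι : Type} {X : ι → DiffSp}
    (v : ∀ i, (X i).tangentPow k) (i : ι) :
    tangentMap k (Hom.piProj i) (tangentPi k v) = v i :=
  Sigma.ext rfl (heq_of_eq (funext fun j ↦ ((v i).2 j).out_eq))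

/-- The smooth curve `t ↦ a + b t` in the reals. -/
def line (a b : ℝ) : Hom DiffSp.real DiffSp.real :=
  Hom.ofContDiff (fun t ↦ a + b * t) (contDiff_const.add (contDiff_const.mul contDiff_id))

/-- The canonical map `ℝ × ℝᵏ → Tᵏ ℝ`, sending `(x, x')` to `(x, [t ↦ x + x'ⱼ t]ⱼ)`. -/
def tangentReal (k : ℕ) (x : ℝ) (x' : Fin k → ℝ) : DiffSp.real.tangentPow k :=
  ⟨x, fun j ↦ Quotient.mk _ ⟨line x (x' j), show x + x' j * 0 = x by simp⟩⟩

/-- The canonical isomorphism `⟦D τ⟧ → Tᵏ ⟦τ⟧` for a first order type `τ`. -/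
def Ty.toTangent (k : ℕ) : (τ : Ty) → τ.FirstOrder → (τ.D k).sem → τ.sem.tangentPow k
  | .real, _ => fun d ↦ tangentReal k (d (0 : Fin 2)) (d (1 : Fin 2))
  | .prod _ σ, h => fun d ↦ tangentPi k fun i ↦ (σ i).toTangent k (h i) (d i)
  | .fn _ _, h => h.elim
  | .variant _ σ, h => fun d ↦
      tangentMap k (Hom.inj (X := fun i ↦ (σ i).sem) d.1) ((σ d.1).toTangent k (h d.1) d.2)
  | .list σ, h => fun d ↦
      tangentMap k (Hom.inj (X := fun m : ℕ ↦ DiffSp.pi fun _ : Fin m ↦ σ.sem) d.1)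
        (tangentPi k fun i ↦ σ.toTangent k h (d.2 i))

/-- The canonical isomorphism `⟦D Γ⟧ → Tᵏ ⟦Γ⟧` for a first order context `Γ`. -/
def Ctx.toTangent (k : ℕ) : (Γ : Ctx) → Γ.FirstOrder →
    Ctx.sem (List.map (Ty.D k) Γ) → (Ctx.sem Γ).tangentPow k
  | [], _ => fun _ ↦ ⟨(), fun _ ↦ Quotient.mk _ ⟨Hom.toUnit, rfl⟩⟩
  | σ :: Γ, h => fun d ↦ tangentProd k (σ.toTangent k (h σ (by simp)) d.1)
      (Ctx.toTangent k Γ (fun τ hτ ↦ h τ (by simp [hτ])) d.2)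

/-- Isomorphisms of diffeological spaces. -/
def IsDiffeo {X Y : DiffSp} (f : X → Y) : Prop :=
  DSmooth f ∧ ∃ g : Y → X, DSmooth g ∧ Function.LeftInverse g f ∧ Function.RightInverse g f

end RevAD

end

/-!
The translation is compared with differentiation along smooth curves by a logical relation between
curves `γ : ℝ → ⟦τ⟧` and points of `⟦Drev τ⟧`. At the reals, a point is related to `γ` if its primal
part is `γ 0` and the chosen component of its backpropagator is multiplication by `γ' 0`; the
relation is componentwise on products, variants and lists, and functions are related if they send
related arguments to related results. The sum, product and chain rules give the real case of the
fundamental lemma: every term sends related arguments to related results. At first order types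
`lamR` turns tangent vectors represented by a curve into a point related to this curve, and `evR`
turns a related point back into tangent vectors represented by the curve. As every tangent vector is
represented by a curve, applying the fundamental lemma to one tangent vector at a time determines
the composite.

The canonical maps are diffeomorphisms by induction on the type, since the fibre powers of the
tangent bundle commute with finite products and with disjoint unions. A tangent vector of a product
is determined by its components because the derivative of a function along a curve is the sum of its
partial derivatives along the components. For smoothness, every plot of a tangent bundle is locally
the family of velocities of a smooth family of curves; such families can be paired, and on a
disjoint union each of them stays in one summand.
-/

noncomputable section

namespace RevAD

/-! ### Semantics of renaming and substitution -/

theorem Hom.exp_ext {X Y : DiffSp} {f g : DiffSp.exp X Y} (h : ∀ x, Hom.toFun f x = Hom.toFun g x) :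
    f = g :=
  Hom.ext (funext h)

theorem Hom.foldAux_congr {E E' X Y : DiffSp} {step : Hom (DiffSp.prod Y (DiffSp.prod X E)) Y}
    {step' : Hom (DiffSp.prod Y (DiffSp.prod X E')) Y} {init : Hom E Y} {init' : Hom E' Y}
    {e : E} {e' : E'} (hstep : ∀ y x, step (y, (x, e)) = step' (y, (x, e')))
    (hinit : init e = init' e') (m : ℕ) (v : Fin m → X) :
    Hom.foldAux step init e m v = Hom.foldAux step' init' e' m v := by
  induction m with
  | zero => exact hinit
  | succ m ih =>
    simp only [Hom.foldAux]
    rw [ih, hstep]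

namespace Ctx

/-- The extension of a point of `⟦Γ⟧` by the value of one more variable. -/
def cons {Γ : Ctx} {σ : Ty} (a : σ.sem) (d : Γ.sem) : Ctx.sem (σ :: Γ) := (a, d)

/-- The extension of a point of `⟦Γ⟧` by the components of a tuple: the pointwise version of
`Ctx.semExt`. -/
def extend {Γ : Ctx} (d : Γ.sem) : (n : ℕ) → (σ : Fin n → Ty) → (∀ i, (σ i).sem) →
    (Γ.ext n σ).sem
  | 0, _, _ => d
  | n + 1, σ, a => cons (a 0) (extend d n (fun i ↦ σ i.succ) fun i ↦ a i.succ)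

theorem semExt_apply {E : DiffSp} {Γ : Ctx} (ρ : Hom E Γ.sem) (n : ℕ) (σ : Fin n → Ty)
    (a : ∀ i, Hom E (σ i).sem) (e : E) :
    semExt ρ n σ a e = extend (ρ e) n σ fun i ↦ a i e := by
  induction n with
  | zero => rfl
  | succ n ih => exact congrArg (cons (a 0 e)) (ih _ _)

theorem sem_ext : ∀ {Γ : Ctx} {d e : Γ.sem}, (∀ ⦃τ⦄ (x : Var Γ τ), x.sem d = x.sem e) → d = e
  | [], _, _, _ => rfl
  | _ :: _, _, _, h => Prod.ext (h .z) (sem_ext fun _ x ↦ h (.s x))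

end Ctx

theorem Var.sem_bound_extend {Γ : Ctx} (d : Γ.sem) (n : ℕ) (σ : Fin n → Ty)
    (a : ∀ i, (σ i).sem) (i : Fin n) :
    (Var.bound (Γ := Γ) n σ i).sem (Ctx.extend d n σ a) = a i := by
  induction n with
  | zero => exact i.elim0
  | succ n ih => exact Fin.cases rfl (ih (fun i ↦ σ i.succ) fun i ↦ a i.succ) i

theorem Var.sem_weaken_extend {Γ : Ctx} {τ : Ty} (d : Γ.sem) (n : ℕ) (σ : Fin n → Ty)
    (a : ∀ i, (σ i).sem) (x : Var Γ τ) :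
    (Var.weaken n σ x).sem (Ctx.extend d n σ a) = x.sem d := by
  induction n with
  | zero => rfl
  | succ n ih => exact ih (fun i ↦ σ i.succ) fun i ↦ a i.succ

theorem Tm.sem_letTuple {Γ : Ctx} {n : ℕ} {σ : Fin n → Ty} {τ : Ty} (t : Tm Γ (Ty.prod n σ))
    (u : Tm (Γ.ext n σ) τ) (d : Γ.sem) :
    (Tm.letTuple t u).sem d = u.sem (Ctx.extend d n σ (t.sem d)) :=
  congrArg u.sem.toFun (Ctx.semExt_apply _ n σ _ d)

section Congruence

variable {Γ Δ : Ctx} {d : Γ.sem} {e : Δ.sem}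

theorem Tm.sem_letTuple_congr {n : ℕ} {σ : Fin n → Ty} {τ : Ty} {t : Tm Γ (Ty.prod n σ)}
    {t' : Tm Δ (Ty.prod n σ)} {u : Tm (Γ.ext n σ) τ} {u' : Tm (Δ.ext n σ) τ}
    (ht : t.sem d = t'.sem e)
    (hu : ∀ a, u.sem (Ctx.extend d n σ a) = u'.sem (Ctx.extend e n σ a)) :
    (letTuple t u).sem d = (letTuple t' u').sem e := by
  rw [sem_letTuple, sem_letTuple, ht]
  exact hu _

theorem Tm.sem_app_congr {σ τ : Ty} {t : Tm Γ (Ty.fn σ τ)} {t' : Tm Δ (Ty.fn σ τ)}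
    {u : Tm Γ σ} {u' : Tm Δ σ} (ht : t.sem d = t'.sem e) (hu : u.sem d = u'.sem e) :
    (app t u).sem d = (app t' u').sem e :=
  congrArg₂ Hom.toFun ht hu

theorem Tm.sem_case_congr {n : ℕ} {σ : Fin n → Ty} {τ : Ty} {t : Tm Γ (Ty.variant n σ)}
    {t' : Tm Δ (Ty.variant n σ)} {u : ∀ i, Tm (σ i :: Γ) τ} {u' : ∀ i, Tm (σ i :: Δ) τ}
    (ht : t.sem d = t'.sem e)
    (hu : ∀ i a, (u i).sem (Ctx.cons a d) = (u' i).sem (Ctx.cons a e)) :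
    (case t u).sem d = (case t' u').sem e := by
  change (u (t.sem d).1).sem (Ctx.cons (t.sem d).2 d) =
    (u' (t'.sem e).1).sem (Ctx.cons (t'.sem e).2 e)
  rw [ht]
  exact hu _ _

theorem Tm.sem_cons_congr {σ : Ty} {t : Tm Γ σ} {t' : Tm Δ σ} {u : Tm Γ (Ty.list σ)}
    {u' : Tm Δ (Ty.list σ)} (ht : t.sem d = t'.sem e) (hu : u.sem d = u'.sem e) :
    (cons t u).sem d = (cons t' u').sem e := by
  change (⟨(u.sem d).1 + 1, Fin.cons (t.sem d) (u.sem d).2⟩ : DiffSp.list _) =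
    ⟨(u'.sem e).1 + 1, Fin.cons (t'.sem e) (u'.sem e).2⟩
  rw [ht, hu]

theorem Tm.sem_fold_congr {σ τ : Ty} {t : Tm (τ :: σ :: Γ) τ} {t' : Tm (τ :: σ :: Δ) τ}
    {u : Tm Γ (Ty.list σ)} {u' : Tm Δ (Ty.list σ)} {v : Tm Γ τ} {v' : Tm Δ τ}
    (ht : ∀ y x, t.sem (Ctx.cons y (Ctx.cons x d)) = t'.sem (Ctx.cons y (Ctx.cons x e)))
    (hu : u.sem d = u'.sem e) (hv : v.sem d = v'.sem e) :
    (fold t u v).sem d = (fold t' u' v').sem e := by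
  change Hom.foldAux _ _ d (u.sem d).1 (u.sem d).2 = Hom.foldAux _ _ e (u'.sem e).1 (u'.sem e).2
  rw [hu]
  exact Hom.foldAux_congr ht hv _ _

end Congruence

namespace Sub

/-- The smooth map `⟦Δ⟧ → ⟦Γ⟧` denoted by a substitution for the variables of `Γ` by terms
over `Δ`. -/
def sem {Δ : Ctx} : {Γ : Ctx} → Sub Γ Δ → Hom Δ.sem Γ.sem
  | [], _ => Hom.toUnit
  | _ :: _, θ => Hom.pair (θ .z).sem (sem fun _ x ↦ θ (.s x))

theorem sem_var {Δ : Ctx} : ∀ {Γ : Ctx} {τ : Ty} (θ : Sub Γ Δ) (x : Var Γ τ) (d : Δ.sem),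
    x.sem (θ.sem d) = (θ x).sem d
  | _, _, _, .z, _ => rfl
  | _, _, θ, .s x, d => sem_var (fun _ y ↦ θ (.s y)) x d

end Sub

namespace Ren

variable {Γ Δ : Ctx}

/-- The smooth map `⟦Δ⟧ → ⟦Γ⟧` denoted by a renaming of the variables of `Γ` by variables
of `Δ`. -/
def sem (r : Ren Γ Δ) : Hom Δ.sem Γ.sem := Sub.sem fun _ x ↦ .var (r x)

theorem sem_var (r : Ren Γ Δ) {τ : Ty} (x : Var Γ τ) (d : Δ.sem) :
    x.sem (r.sem d) = (r x).sem d :=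
  Sub.sem_var _ x d

theorem sem_lift (r : Ren Γ Δ) (σ : Ty) (a : σ.sem) (d : Δ.sem) :
    (r.lift σ).sem (Ctx.cons a d) = Ctx.cons a (r.sem d) :=
  Ctx.sem_ext fun _ x ↦ (sem_var _ x _).trans <| match x with
    | .z => rfl
    | .s x => (sem_var r x d).symm

theorem sem_liftN (r : Ren Γ Δ) (n : ℕ) (σ : Fin n → Ty) (a : ∀ i, (σ i).sem) (d : Δ.sem) :
    (r.liftN n σ).sem (Ctx.extend d n σ a) = Ctx.extend (r.sem d) n σ a := by
  induction n with
  | zero => rfl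
  | succ n ih => exact (sem_lift _ _ _ _).trans (congrArg (Ctx.cons (a 0)) (ih _ _))

end Ren

namespace Tm

theorem sem_rename {Γ : Ctx} {τ : Ty} (t : Tm Γ τ) : ∀ {Δ : Ctx} (r : Ren Γ Δ) (d : Δ.sem),
    (t.rename r).sem d = t.sem (r.sem d) := by
  induction t with
  | var x => exact fun r d ↦ (r.sem_var x d).symm
  | cst c => exact fun _ _ ↦ rfl
  | add t u iht ihu => exact fun r d ↦ congrArg₂ (fun a b : ℝ ↦ a + b) (iht r d) (ihu r d)
  | mul t u iht ihu => exact fun r d ↦ congrArg₂ (fun a b : ℝ ↦ a * b) (iht r d) (ihu r d)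
  | sigmoid t ih => exact fun r d ↦ congrArg Hom.sigmoid.toFun (ih r d)
  | tuple t ih => exact fun r d ↦ funext fun i ↦ ih i r d
  | letTuple t u iht ihu =>
    exact fun r d ↦ sem_letTuple_congr (iht r d) fun a ↦
      (ihu _ _).trans (congrArg u.sem.toFun (r.sem_liftN _ _ a d))
  | lam t ih =>
    exact fun r d ↦ Hom.exp_ext fun a ↦ (ih _ _).trans (congrArg t.sem.toFun (r.sem_lift _ a d))
  | app t u iht ihu => exact fun r d ↦ sem_app_congr (iht r d) (ihu r d)
  | inj i t ih => exact fun r d ↦ congrArg (Sigma.mk i) (ih r d)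
  | case t u iht ihu =>
    exact fun r d ↦ sem_case_congr (iht r d) fun i a ↦
      (ihu i _ _).trans (congrArg (u i).sem.toFun (r.sem_lift _ a d))
  | nil => exact fun _ _ ↦ rfl
  | cons t u iht ihu => exact fun r d ↦ sem_cons_congr (iht r d) (ihu r d)
  | fold t u v iht ihu ihv =>
    refine fun r d ↦ sem_fold_congr (fun y x ↦ ?_) (ihu r d) (ihv r d)
    rw [iht, Ren.sem_lift, Ren.sem_lift]

theorem sem_wk {Γ : Ctx} {σ τ : Ty} (t : Tm Γ τ) (a : σ.sem) (d : Γ.sem) :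
    (t.wk (σ := σ)).sem (Ctx.cons a d) = t.sem d :=
  (t.sem_rename _ _).trans <| congrArg t.sem.toFun <| Ctx.sem_ext fun _ _ ↦ Ren.sem_var _ _ _

theorem sem_wkN {Γ : Ctx} {τ : Ty} (t : Tm Γ τ) (n : ℕ) (σ : Fin n → Ty)
    (a : ∀ i, (σ i).sem) (d : Γ.sem) : (t.wkN n σ).sem (Ctx.extend d n σ a) = t.sem d :=
  (t.sem_rename _ _).trans <| congrArg t.sem.toFun <| Ctx.sem_ext fun _ x ↦
    (Ren.sem_var _ x _).trans (Var.sem_weaken_extend d n σ a x)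

end Tm

namespace Sub

variable {Γ Δ : Ctx}

theorem sem_lift (θ : Sub Γ Δ) (σ : Ty) (a : σ.sem) (d : Δ.sem) :
    (θ.lift σ).sem (Ctx.cons a d) = Ctx.cons a (θ.sem d) :=
  Ctx.sem_ext fun _ x ↦ (sem_var _ x _).trans <| match x with
    | .z => rfl
    | .s x => ((θ x).sem_wk a d).trans (sem_var θ x d).symm

theorem sem_liftN (θ : Sub Γ Δ) (n : ℕ) (σ : Fin n → Ty) (a : ∀ i, (σ i).sem) (d : Δ.sem) :
    (θ.liftN n σ).sem (Ctx.extend d n σ a) = Ctx.extend (θ.sem d) n σ a := by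
  induction n with
  | zero => rfl
  | succ n ih => exact (sem_lift _ _ _ _).trans (congrArg (Ctx.cons (a 0)) (ih _ _))

end Sub

theorem Tm.sem_subst {Γ : Ctx} {τ : Ty} (t : Tm Γ τ) : ∀ {Δ : Ctx} (θ : Sub Γ Δ) (d : Δ.sem),
    (t.subst θ).sem d = t.sem (θ.sem d) := by
  induction t with
  | var x => exact fun θ d ↦ (θ.sem_var x d).symm
  | cst c => exact fun _ _ ↦ rfl
  | add t u iht ihu => exact fun θ d ↦ congrArg₂ (fun a b : ℝ ↦ a + b) (iht θ d) (ihu θ d)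
  | mul t u iht ihu => exact fun θ d ↦ congrArg₂ (fun a b : ℝ ↦ a * b) (iht θ d) (ihu θ d)
  | sigmoid t ih => exact fun θ d ↦ congrArg Hom.sigmoid.toFun (ih θ d)
  | tuple t ih => exact fun θ d ↦ funext fun i ↦ ih i θ d
  | letTuple t u iht ihu =>
    exact fun θ d ↦ sem_letTuple_congr (iht θ d) fun a ↦
      (ihu _ _).trans (congrArg u.sem.toFun (θ.sem_liftN _ _ a d))
  | lam t ih =>
    exact fun θ d ↦ Hom.exp_ext fun a ↦ (ih _ _).trans (congrArg t.sem.toFun (θ.sem_lift _ a d))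
  | app t u iht ihu => exact fun θ d ↦ sem_app_congr (iht θ d) (ihu θ d)
  | inj i t ih => exact fun θ d ↦ congrArg (Sigma.mk i) (ih θ d)
  | case t u iht ihu =>
    exact fun θ d ↦ sem_case_congr (iht θ d) fun i a ↦
      (ihu i _ _).trans (congrArg (u i).sem.toFun (θ.sem_lift _ a d))
  | nil => exact fun _ _ ↦ rfl
  | cons t u iht ihu => exact fun θ d ↦ sem_cons_congr (iht θ d) (ihu θ d)
  | fold t u v iht ihu ihv =>
    refine fun θ d ↦ sem_fold_congr (fun y x ↦ ?_) (ihu θ d) (ihv θ d)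
    rw [iht, Sub.sem_lift, Sub.sem_lift]

/-! ### The logical relation -/

namespace Hom

theorem contDiff_real (γ : Hom DiffSp.real DiffSp.real) :
    ContDiff (F := ℝ) ℝ ∞ (fun t : ℝ ↦ γ t) :=
  DSmooth.contDiff (X := ℝ) (Y := ℝ) γ.smooth

/-- The value at time zero of a smooth curve in the reals. -/
def value₀ (γ : Hom DiffSp.real DiffSp.real) : ℝ := γ (0 : ℝ)

/-- The derivative at time zero of a smooth curve in the reals. -/
def deriv₀ (γ : Hom DiffSp.real DiffSp.real) : ℝ := deriv (F := ℝ) (fun t : ℝ ↦ γ t) 0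

theorem hasDerivAt_deriv₀ (γ : Hom DiffSp.real DiffSp.real) :
    HasDerivAt (F := ℝ) (fun t : ℝ ↦ γ t) γ.deriv₀ 0 :=
  (γ.contDiff_real.differentiable (by simp) _).hasDerivAt

variable (γ δ : Hom DiffSp.real DiffSp.real)

theorem deriv₀_const (c : ℝ) : (const (X := DiffSp.real) (Y := DiffSp.real) c).deriv₀ = 0 :=
  deriv_const (0 : ℝ) c

theorem deriv₀_add : (add γ δ).deriv₀ = γ.deriv₀ + δ.deriv₀ :=
  (γ.hasDerivAt_deriv₀.add δ.hasDerivAt_deriv₀).deriv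

theorem deriv₀_mul :
    (mul γ δ).deriv₀ = γ.deriv₀ * δ.value₀ + γ.value₀ * δ.deriv₀ :=
  (γ.hasDerivAt_deriv₀.mul δ.hasDerivAt_deriv₀).deriv

theorem sigmoid_apply (x : ℝ) : sigmoid x = Real.sigmoid x := one_div (1 + Real.exp (-x))

theorem deriv₀_sigmoid :
    (comp sigmoid γ).deriv₀ =
      Real.sigmoid γ.value₀ * (1 - Real.sigmoid γ.value₀) * γ.deriv₀ :=
  (congrArg (fun f : ℝ → ℝ ↦ deriv f 0) (funext fun t : ℝ ↦ sigmoid_apply (γ t))).trans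
    ((Real.hasDerivAt_sigmoid γ.value₀).comp (0 : ℝ) γ.hasDerivAt_deriv₀).deriv

end Hom

namespace Ty

variable {k : ℕ}

/-- The primal part of a point of `⟦Drev real⟧`. -/
def primal (d : (Ty.real.Drev k).sem) : ℝ := d (0 : Fin 2)

/-- The backpropagator of a point of `⟦Drev real⟧`, as a function. -/
def backprop (d : (Ty.real.Drev k).sem) (z : ℝ) : Fin k → ℝ :=
  Hom.toFun (X := DiffSp.real) (Y := (Ty.vec k).sem) (d (1 : Fin 2)) z

/-- The logical relation between smooth curves in `⟦τ⟧` and points of `⟦Drev τ⟧`. At the reals, the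
primal part is the value of the curve at time zero, and for `j ∈ J` the `j`-th component of the
backpropagator is multiplication by the derivative of the curve. At first order types, a point that
represents `k` tangent vectors is related to a curve through the `j`-th of them for `J = {j}`, and
to a curve through the base point alone for `J = ∅`. -/
def Rel (J : Set (Fin k)) : (τ : Ty) → Hom DiffSp.real τ.sem → (τ.Drev k).sem → Prop
  | .real, γ, d => primal d = γ.value₀ ∧ ∀ j ∈ J, ∀ z, backprop d z j = z * γ.deriv₀
  | .prod _ σ, γ, d => ∀ i, (σ i).Rel J
      (Hom.comp (Hom.piProj (X := fun i ↦ (σ i).sem) i) γ) (d i)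
  | .fn σ τ, γ, d => ∀ a a', σ.Rel J a a' → τ.Rel J (Hom.app γ a) (Hom.toFun d a')
  | .variant _ σ, γ, d => ∃ γ' : Hom DiffSp.real (σ d.1).sem,
      γ = Hom.comp (Hom.inj (X := fun i ↦ (σ i).sem) d.1) γ' ∧ (σ d.1).Rel J γ' d.2
  | .list σ, γ, d => ∃ γ' : Fin d.1 → Hom DiffSp.real σ.sem,
      γ = Hom.comp (Hom.inj (X := fun m : ℕ ↦ DiffSp.pi fun _ : Fin m ↦ σ.sem) d.1)
        (Hom.piLift γ') ∧ ∀ i, σ.Rel J (γ' i) (d.2 i)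

end Ty

namespace Ctx

variable {k : ℕ} {J : Set (Fin k)}

/-- The logical relation at contexts. -/
def Rel (J : Set (Fin k)) :
    (Γ : Ctx) → Hom DiffSp.real Γ.sem → Ctx.sem (List.map (Ty.Drev k) Γ) → Prop
  | [], _, _ => True
  | σ :: Γ, γ, d => σ.Rel J (Hom.comp Hom.fst γ) d.1 ∧ Rel J Γ (Hom.comp Hom.snd γ) d.2

/-- The extension of a point of a context translated by `f`: up to the equality `Ctx.map_ext` of
contexts this is `Ctx.extend`. -/
def extendMap (f : Ty → Ty) {Γ : Ctx} (d : Ctx.sem (List.map f Γ)) : (n : ℕ) → (σ : Fin n → Ty) →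
    (∀ i, (f (σ i)).sem) → Ctx.sem (List.map f (Γ.ext n σ))
  | 0, _, _ => d
  | n + 1, σ, a => cons (a 0) (extendMap f d n (fun i ↦ σ i.succ) fun i ↦ a i.succ)

theorem heq_cons {Γ Δ : Ctx} (h : Γ = Δ) {σ : Ty} (a : σ.sem) {d : Γ.sem} {e : Δ.sem}
    (hd : d ≍ e) : cons a d ≍ cons a e := by
  subst h hd
  rfl

theorem heq_extendMap (f : Ty → Ty) {Γ : Ctx} (d : Ctx.sem (List.map f Γ)) (n : ℕ)
    (σ : Fin n → Ty) (a : ∀ i, (f (σ i)).sem) :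
    extendMap f d n σ a ≍ extend d n (fun i ↦ f (σ i)) a := by
  induction n with
  | zero => rfl
  | succ n ih => exact heq_cons (map_ext f Γ n _) _ (ih _ _)

theorem comp_semExt {E E' : DiffSp} {Γ : Ctx} (ρ : Hom E Γ.sem) (n : ℕ) (σ : Fin n → Ty)
    (a : ∀ i, Hom E (σ i).sem) (f : Hom E' E) :
    Hom.comp (semExt ρ n σ a) f = semExt (Hom.comp ρ f) n σ fun i ↦ Hom.comp (a i) f := by
  induction n with
  | zero => rfl
  | succ n ih => exact congrArg (Hom.pair (Hom.comp (a 0) f)) (ih _ fun i ↦ a i.succ)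

theorem Rel.extend {Γ : Ctx} {γ : Hom DiffSp.real Γ.sem} {d : Ctx.sem (List.map (Ty.Drev k) Γ)}
    (h : Rel J Γ γ d) {n : ℕ} {σ : Fin n → Ty} {a : ∀ i, Hom DiffSp.real (σ i).sem}
    {a' : ∀ i, ((σ i).Drev k).sem} (ha : ∀ i, (σ i).Rel J (a i) (a' i)) :
    Rel J (Γ.ext n σ) (semExt γ n σ a) (extendMap (Ty.Drev k) d n σ a') := by
  induction n with
  | zero => exact h
  | succ n ih => exact ⟨ha 0, ih fun i ↦ ha i.succ⟩

end Ctx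

theorem Tm.sem_castCtx {Γ Δ : Ctx} {τ : Ty} (h : Γ = Δ) (t : Tm Γ τ) {d : Γ.sem} {e : Δ.sem}
    (hd : d ≍ e) : (castCtx h t).sem e = t.sem d := by
  subst h hd
  rfl

theorem Var.rel {k : ℕ} {J : Set (Fin k)} : ∀ {Γ : Ctx} {τ : Ty} (x : Var Γ τ)
    {γ : Hom DiffSp.real Γ.sem} {d : Ctx.sem (List.map (Ty.Drev k) Γ)}, Ctx.Rel J Γ γ d →
      τ.Rel J (Hom.comp x.sem γ) ((x.map (Ty.Drev k)).sem d)
  | _, _, .z, _, _, h => h.1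
  | _, _, .s x, _, _, h => x.rel h.2

/-! ### The translated operations on the reals -/

namespace Tm

variable {k : ℕ} {Γ : Ctx}

theorem sem_addVec (t u : Tm Γ (Ty.vec k)) (d : Γ.sem) (i : Fin k) :
    ((addVec t u).sem d i : ℝ) = HAdd.hAdd (α := ℝ) (β := ℝ) (t.sem d i) (u.sem d i) := by
  refine (congrFun ((sem_letTuple t _ d).trans (sem_letTuple _ _ _)) i).trans ?_
  refine congrArg₂ (fun a b : ℝ ↦ a + b) ?_ ?_
  · exact (Var.sem_weaken_extend _ k _ _ _).trans (Var.sem_bound_extend d k _ _ i)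
  · exact (Var.sem_bound_extend _ k _ _ i).trans (congrFun (sem_wkN u k _ _ d) i)

theorem sem_letPair_letPair {σ σ' ρ ρ' τ : Ty} (t : Tm Γ (Ty.pair σ σ')) (u : Tm Γ (Ty.pair ρ ρ'))
    (v : Tm (ρ :: ρ' :: σ :: σ' :: Γ) τ) (d : Γ.sem) :
    (letPair t (letPair u.wk.wk v)).sem d =
      v.sem (Ctx.cons (u.sem d (0 : Fin 2)) (Ctx.cons (u.sem d (1 : Fin 2))
        (Ctx.cons (t.sem d (0 : Fin 2)) (Ctx.cons (t.sem d (1 : Fin 2)) d)))) := by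
  have hu : u.wk.wk.sem (Ctx.cons (t.sem d (0 : Fin 2)) (Ctx.cons (t.sem d (1 : Fin 2)) d)) =
      u.sem d := (sem_wk _ _ _).trans (sem_wk _ _ _)
  exact congrArg (fun p : (Ty.pair ρ ρ').sem ↦ v.sem (Ctx.cons (p (0 : Fin 2))
    (Ctx.cons (p (1 : Fin 2)) (Ctx.cons (t.sem d (0 : Fin 2))
      (Ctx.cons (t.sem d (1 : Fin 2)) d))))) hu

theorem backprop_pair_lam_addVec (p : Tm Γ .real) (t u : Tm (.real :: Γ) (Ty.vec k)) (d : Γ.sem)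
    (z : ℝ) (j : Fin k) :
    Ty.backprop ((pair p (.lam (addVec t u))).sem d) z j =
      HAdd.hAdd (α := ℝ) (β := ℝ) (t.sem (Ctx.cons (σ := .real) z d) j)
        (u.sem (Ctx.cons (σ := .real) z d) j) :=
  sem_addVec t u _ j

variable (t u : Tm Γ (Ty.real.Drev k)) (d : Γ.sem) (z : ℝ) (j : Fin k)

theorem primal_addRev :
    Ty.primal ((addRev k t u).sem d) = Ty.primal (t.sem d) + Ty.primal (u.sem d) :=
  congrArg Ty.primal (sem_letPair_letPair t u _ d)

theorem backprop_addRev :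
    Ty.backprop ((addRev k t u).sem d) z j =
      Ty.backprop (t.sem d) z j + Ty.backprop (u.sem d) z j :=
  (congrArg (Ty.backprop · z j) (sem_letPair_letPair t u _ d)).trans
    (backprop_pair_lam_addVec _ _ _ _ z j)

theorem primal_mulRev :
    Ty.primal ((mulRev k t u).sem d) = Ty.primal (t.sem d) * Ty.primal (u.sem d) :=
  congrArg Ty.primal (sem_letPair_letPair t u _ d)

theorem backprop_mulRev :
    Ty.backprop ((mulRev k t u).sem d) z j =
      Ty.backprop (t.sem d) (Ty.primal (u.sem d) * z) j +
        Ty.backprop (u.sem d) (Ty.primal (t.sem d) * z) j :=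
  (congrArg (Ty.backprop · z j) (sem_letPair_letPair t u _ d)).trans
    (backprop_pair_lam_addVec _ _ _ _ z j)

theorem primal_sigmoidRev :
    Ty.primal ((sigmoidRev k t).sem d) = Real.sigmoid (Ty.primal (t.sem d)) :=
  Hom.sigmoid_apply _

theorem backprop_sigmoidRev :
    Ty.backprop ((sigmoidRev k t).sem d) z j = Ty.backprop (t.sem d)
      (Real.sigmoid (Ty.primal (t.sem d)) * (1 - Real.sigmoid (Ty.primal (t.sem d))) * z) j := by
  have hsub (s : ℝ) : s * (1 - s) * z = s * (1 + -1 * s) * z := by ring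
  rw [hsub]
  exact congrArg (fun s : ℝ ↦ Ty.backprop (t.sem d) (s * (1 + -1 * s) * z) j)
    (Hom.sigmoid_apply (Ty.primal (t.sem d)))

end Tm

namespace Ty.Rel

section Real

variable {k : ℕ} {J : Set (Fin k)} {Γ : Ctx} {t u : Tm Γ (Ty.real.Drev k)} {d : Γ.sem}
  {γ δ : Hom DiffSp.real DiffSp.real}

theorem cstRev (c : ℝ) (d : Γ.sem) :
    Ty.real.Rel J (Hom.const (X := DiffSp.real) (Y := DiffSp.real) c)
      ((Tm.cstRev k c).sem d) :=
  ⟨rfl, fun _ _ z ↦ (mul_eq_zero_of_right z (Hom.deriv₀_const c)).symm⟩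

theorem addRev (ht : Ty.real.Rel J γ (t.sem d)) (hu : Ty.real.Rel J δ (u.sem d)) :
    Ty.real.Rel J (Hom.add γ δ) ((Tm.addRev k t u).sem d) := by
  refine ⟨(Tm.primal_addRev t u d).trans (congrArg₂ (fun a b : ℝ ↦ a + b) ht.1 hu.1),
    fun j hj z ↦ ?_⟩
  rw [Tm.backprop_addRev, ht.2 j hj, hu.2 j hj, Hom.deriv₀_add, mul_add]

theorem mulRev (ht : Ty.real.Rel J γ (t.sem d)) (hu : Ty.real.Rel J δ (u.sem d)) :
    Ty.real.Rel J (Hom.mul γ δ) ((Tm.mulRev k t u).sem d) := by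
  refine ⟨(Tm.primal_mulRev t u d).trans (congrArg₂ (fun a b : ℝ ↦ a * b) ht.1 hu.1),
    fun j hj z ↦ ?_⟩
  refine Eq.trans ?_ (congrArg (z * ·) (Hom.deriv₀_mul γ δ)).symm
  rw [Tm.backprop_mulRev, ht.2 j hj, hu.2 j hj, ht.1, hu.1]
  ring

theorem sigmoidRev (ht : Ty.real.Rel J γ (t.sem d)) :
    Ty.real.Rel J (Hom.comp Hom.sigmoid γ) ((Tm.sigmoidRev k t).sem d) := by
  refine ⟨(Tm.primal_sigmoidRev t d).trans ?_, fun j hj z ↦ ?_⟩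
  · exact (congrArg Real.sigmoid ht.1).trans (Hom.sigmoid_apply γ.value₀).symm
  · refine Eq.trans ?_ (congrArg (z * ·) (Hom.deriv₀_sigmoid γ)).symm
    rw [Tm.backprop_sigmoidRev, ht.2 j hj, ht.1]
    ring

end Real

section Data

variable {k : ℕ} {J : Set (Fin k)} {E : DiffSp} {δ : Hom DiffSp.real E}

theorem case {n : ℕ} {σ : Fin n → Ty} {τ : Ty} {f : ∀ i, Hom (DiffSp.prod (σ i).sem E) τ.sem}
    {f' : ∀ i, ((σ i).Drev k).sem → (τ.Drev k).sem} {γ : Hom DiffSp.real (Ty.variant n σ).sem}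
    {d : ((Ty.variant n σ).Drev k).sem} (h : (Ty.variant n σ).Rel J γ d)
    (hf : ∀ i γ' d', (σ i).Rel J γ' d' → τ.Rel J (Hom.comp (f i) (Hom.pair γ' δ)) (f' i d')) :
    τ.Rel J (Hom.comp (Hom.case f) (Hom.pair γ δ)) (f' d.1 d.2) := by
  obtain ⟨γ', rfl, h⟩ := h
  exact hf _ γ' _ h

theorem nil {σ : Ty} : (Ty.list σ).Rel J (Hom.nil (X := σ.sem)) ⟨0, fun i ↦ i.elim0⟩ :=
  ⟨fun i ↦ i.elim0, Hom.ext (funext fun _ ↦ congrArg (Sigma.mk 0) (funext fun i ↦ i.elim0)),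
    fun i ↦ i.elim0⟩

theorem cons {σ : Ty} {γ : Hom DiffSp.real σ.sem} {l : Hom DiffSp.real (Ty.list σ).sem}
    {d : (σ.Drev k).sem} {l' : ((Ty.list σ).Drev k).sem} (h : σ.Rel J γ d)
    (hl : (Ty.list σ).Rel J l l') :
    (Ty.list σ).Rel J (Hom.cons γ l) ⟨l'.1 + 1, Fin.cons d l'.2⟩ := by
  obtain ⟨γ', rfl, hl⟩ := hl
  refine ⟨Fin.cons γ γ', Hom.ext (funext fun s ↦ ?_), Fin.cases h hl⟩
  exact congrArg (Sigma.mk (l'.1 + 1)) (funext (Fin.cases rfl fun _ ↦ rfl))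

section Fold

variable {E' : DiffSp} {σ τ : Ty} {step : Hom (DiffSp.prod τ.sem (DiffSp.prod σ.sem E)) τ.sem}
  {step' : Hom (DiffSp.prod (τ.Drev k).sem (DiffSp.prod (σ.Drev k).sem E')) (τ.Drev k).sem}
  {init : Hom E τ.sem} {init' : Hom E' (τ.Drev k).sem} {d : E'}

theorem exists_foldAux
    (hstep : ∀ y y' x x', τ.Rel J y y' → σ.Rel J x x' →
      τ.Rel J (Hom.comp step (Hom.pair y (Hom.pair x δ))) (step' (y', (x', d))))
    (hinit : τ.Rel J (Hom.comp init δ) (init' d)) (m : ℕ) (l : Fin m → Hom DiffSp.real σ.sem)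
    (l' : Fin m → (σ.Drev k).sem) (hl : ∀ i, σ.Rel J (l i) (l' i)) :
    ∃ γ : Hom DiffSp.real τ.sem, (∀ s, γ s = Hom.foldAux step init (δ s) m fun i ↦ l i s) ∧
      τ.Rel J γ (Hom.foldAux step' init' d m l') := by
  induction m with
  | zero => exact ⟨_, fun _ ↦ rfl, hinit⟩
  | succ m ih =>
    obtain ⟨γ, hγ, hr⟩ := ih (fun i ↦ l i.succ) (fun i ↦ l' i.succ) fun i ↦ hl i.succ
    exact ⟨_, fun s ↦ congrArg (fun y ↦ step (y, (l 0 s, δ s))) (hγ s),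
      hstep γ _ (l 0) _ hr (hl 0)⟩

theorem fold {u : Hom E (Ty.list σ).sem} {u' : Hom E' ((Ty.list σ).Drev k).sem}
    (hstep : ∀ y y' x x', τ.Rel J y y' → σ.Rel J x x' →
      τ.Rel J (Hom.comp step (Hom.pair y (Hom.pair x δ))) (step' (y', (x', d))))
    (hu : (Ty.list σ).Rel J (Hom.comp u δ) (u' d)) (hinit : τ.Rel J (Hom.comp init δ) (init' d)) :
    τ.Rel J (Hom.comp (Hom.fold step u init) δ) (Hom.fold step' u' init' d) := by
  obtain ⟨l, hul, hl⟩ := hu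
  obtain ⟨γ, hγ, hr⟩ := exists_foldAux hstep hinit _ l _ hl
  have hfold : Hom.comp (Hom.fold step u init) δ = γ := Hom.ext (funext fun s ↦
    (congrArg (fun v : (Ty.list σ).sem ↦ Hom.foldAux step init (δ s) v.1 v.2)
      (congrArg (fun f ↦ Hom.toFun f s) hul)).trans (hγ s).symm)
  rw [hfold]
  exact hr

end Fold

end Data

end Ty.Rel

/-! ### The fundamental lemma -/

theorem Tm.rel {k : ℕ} {J : Set (Fin k)} {Γ : Ctx} {τ : Ty} (t : Tm Γ τ) :
    ∀ {γ : Hom DiffSp.real Γ.sem} {d : Ctx.sem (List.map (Ty.Drev k) Γ)}, Ctx.Rel J Γ γ d →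
      τ.Rel J (Hom.comp t.sem γ) ((t.Drev k).sem d) := by
  induction t with
  | var x => exact fun h ↦ x.rel h
  | cst c => exact fun _ ↦ Ty.Rel.cstRev c _
  | add t u iht ihu => exact fun h ↦ Ty.Rel.addRev (iht h) (ihu h)
  | mul t u iht ihu => exact fun h ↦ Ty.Rel.mulRev (iht h) (ihu h)
  | sigmoid _ ih => exact fun h ↦ Ty.Rel.sigmoidRev (ih h)
  | tuple _ ih => exact fun h i ↦ ih i h
  | @letTuple Γ n σ τ t u iht ihu =>
    intro γ d h
    have hγ : Hom.comp (letTuple t u).sem γ = Hom.comp u.sem (Ctx.semExt γ n σ fun i ↦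
        Hom.comp (Hom.comp (Hom.piProj (X := fun i ↦ (σ i).sem) i) t.sem) γ) :=
      congrArg (Hom.comp u.sem) (Ctx.comp_semExt _ n σ _ γ)
    have hd : ((letTuple t u).Drev k).sem d =
        (u.Drev k).sem (Ctx.extendMap (Ty.Drev k) d n σ ((t.Drev k).sem d)) :=
      (sem_letTuple (t.Drev k) _ d).trans
        (sem_castCtx (Ctx.map_ext _ _ _ _) (u.Drev k) (Ctx.heq_extendMap (Ty.Drev k) d n σ _))
    rw [hγ, hd]
    exact ihu (h.extend (iht h))
  | lam _ ih => exact fun {γ d} h a a' ha ↦ ih (γ := Hom.pair a γ) (d := Ctx.cons a' d) ⟨ha, h⟩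
  | app _ _ iht ihu => exact fun h ↦ iht h _ _ (ihu h)
  | inj _ _ ih => exact fun h ↦ ⟨_, rfl, ih h⟩
  | case _ _ iht ihu =>
    exact fun {γ d} h ↦ Ty.Rel.case (iht h) fun i γ' d' h' ↦
      ihu i (γ := Hom.pair γ' γ) (d := Ctx.cons d' d) ⟨h', h⟩
  | nil => exact fun _ ↦ Ty.Rel.nil
  | cons t u iht ihu => exact fun h ↦ Ty.Rel.cons (iht h) (ihu h)
  | fold _ _ _ iht ihu ihv =>
    exact fun {γ d} h ↦ Ty.Rel.fold (fun y y' x x' hy hx ↦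
      iht (γ := Hom.pair y (Hom.pair x γ)) (d := Ctx.cons y' (Ctx.cons x' d)) ⟨hy, hx, h⟩)
      (ihu h) (ihv h)

/-! ### Diffeomorphisms -/

namespace IsDiffeo

theorem of_lift {X Y : DiffSp} {f : X → Y} (hf : DSmooth f) (hinj : Function.Injective f)
    (hlift : ∀ (n : ℕ) (p : EuclideanSpace ℝ (Fin n) → Y), IsPlot p →
      ∃ q : EuclideanSpace ℝ (Fin n) → X, IsPlot q ∧ ∀ u, f (q u) = p u) : IsDiffeo f := by
  have hsurj : Function.Surjective f := fun y ↦ by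
    obtain ⟨q, -, hq⟩ := hlift 0 (fun _ ↦ y) (DiffeologicalSpace.constant_plots y)
    exact ⟨_, hq 0⟩
  choose g hg using hsurj
  refine ⟨hf, g, fun n p hp ↦ ?_, fun x ↦ hinj (hg _), hg⟩
  obtain ⟨q, hq, hpq⟩ := hlift n p hp
  have hgp : g ∘ p = q := funext fun u ↦ hinj ((hg _).trans (hpq u).symm)
  rwa [hgp]

theorem comp {X Y Z : DiffSp} {g : Y → Z} {f : X → Y} (hg : IsDiffeo g) (hf : IsDiffeo f) :
    IsDiffeo (X := X) (Y := Z) (fun x ↦ g (f x)) := by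
  obtain ⟨hg, g', hg', hlg, hrg⟩ := hg
  obtain ⟨hf, f', hf', hlf, hrf⟩ := hf
  exact ⟨hg.comp hf, f' ∘ g', hf'.comp hg', hlg.comp hlf, hrg.comp hrf⟩

theorem piMap {ι : Type} {X Y : ι → DiffSp} {f : ∀ i, X i → Y i} (hf : ∀ i, IsDiffeo (f i)) :
    IsDiffeo (X := DiffSp.pi X) (Y := DiffSp.pi Y) (fun x i ↦ f i (x i)) := by
  choose hf g hg hl hr using hf
  exact ⟨fun _ _ hp ↦ DiffSp.isPlot_pi.2 fun i ↦ hf i _ _ (DiffSp.isPlot_pi.1 hp i),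
    fun y i ↦ g i (y i),
    fun _ _ hp ↦ DiffSp.isPlot_pi.2 fun i ↦ hg i _ _ (DiffSp.isPlot_pi.1 hp i),
    fun x ↦ funext fun i ↦ hl i (x i), fun y ↦ funext fun i ↦ hr i (y i)⟩

theorem prodMap {X Y X' Y' : DiffSp} {f : X → Y} {f' : X' → Y'} (hf : IsDiffeo f)
    (hf' : IsDiffeo f') :
    IsDiffeo (X := DiffSp.prod X X') (Y := DiffSp.prod Y Y') (fun x ↦ (f x.1, f' x.2)) := by
  obtain ⟨hf, g, hg, hl, hr⟩ := hf
  obtain ⟨hf', g', hg', hl', hr'⟩ := hf'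
  exact ⟨fun _ _ hp ↦ DiffSp.isPlot_prod.2
      ⟨hf _ _ (DiffSp.isPlot_prod.1 hp).1, hf' _ _ (DiffSp.isPlot_prod.1 hp).2⟩,
    fun y ↦ (g y.1, g' y.2),
    fun _ _ hp ↦ DiffSp.isPlot_prod.2
      ⟨hg _ _ (DiffSp.isPlot_prod.1 hp).1, hg' _ _ (DiffSp.isPlot_prod.1 hp).2⟩,
    fun x ↦ Prod.ext (hl x.1) (hl' x.2), fun y ↦ Prod.ext (hr y.1) (hr' y.2)⟩

theorem sigmaMap {ι : Type} {X Y : ι → DiffSp} {f : ∀ i, X i → Y i} (hf : ∀ i, IsDiffeo (f i)) :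
    IsDiffeo (X := DiffSp.sigma X) (Y := DiffSp.sigma Y) (fun x ↦ ⟨x.1, f x.1 x.2⟩) := by
  choose hf g hg hl hr using hf
  refine ⟨?_, fun y ↦ ⟨y.1, g y.1 y.2⟩, ?_, fun x ↦ Sigma.ext rfl (heq_of_eq (hl _ x.2)),
    fun y ↦ Sigma.ext rfl (heq_of_eq (hr _ y.2))⟩
  · rintro n _ ⟨i, q, hq, rfl⟩
    exact ⟨i, _, hf i n q hq, rfl⟩
  · rintro n _ ⟨i, q, hq, rfl⟩
    exact ⟨i, _, hg i n q hq, rfl⟩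

end IsDiffeo

/-! ### Maps out of Euclidean spaces -/

theorem DiffSp.isPlot_prod_euc_real {n m : ℕ}
    {p : EuclideanSpace ℝ (Fin m) → EuclideanSpace ℝ (Fin n) × ℝ} :
    IsPlot (X := prod (euc n) real) p ↔ ContDiff ℝ ∞ p :=
  isPlot_prod.trans ⟨fun h ↦ ContDiff.prodMk (isPlot_euc.1 h.1) (isPlot_real.1 h.2),
    fun h ↦ ⟨isPlot_euc.2 h.fst, isPlot_real.2 h.snd⟩⟩

namespace Hom

theorem contDiff_prod {n : ℕ} (F : Hom (DiffSp.prod (DiffSp.euc n) DiffSp.real) DiffSp.real) :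
    ContDiff (E := EuclideanSpace ℝ (Fin n) × ℝ) (F := ℝ) ℝ ∞ F.toFun := by
  let g := toEuclidean (E := EuclideanSpace ℝ (Fin n) × ℝ)
  have hF : ContDiff (F := ℝ) ℝ ∞ (fun u ↦ F (g.symm u)) :=
    F.smooth _ _ (DiffSp.isPlot_prod_euc_real.2 g.symm.contDiff)
  have hFg : F.toFun = (fun u ↦ F (g.symm u)) ∘ g :=
    funext fun z ↦ congrArg F.toFun (g.symm_apply_apply z).symm
  exact hFg ▸ hF.comp g.contDiff

theorem exists_eq_inj_comp {ι : Type} {X : ι → DiffSp} {Y : DiffSp} {m : ℕ}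
    (r : Hom (DiffSp.euc m) Y) (s : Hom Y (DiffSp.euc m)) (hrs : ∀ y, r (s y) = y)
    (F : Hom Y (DiffSp.sigma X)) : ∃ (i : ι) (F' : Hom Y (X i)), F = comp (inj i) F' := by
  obtain ⟨i, q, hq, hF⟩ := F.smooth m r.toFun (r.smooth m _ isPlot_id)
  exact ⟨i, comp ⟨q, hq.dSmooth⟩ s, Hom.ext (funext fun y ↦
    (congrArg F.toFun (hrs y)).symm.trans (congrFun hF (s y)))⟩

theorem exists_eq_inj_comp_real {ι : Type} {X : ι → DiffSp} (F : Hom DiffSp.real (DiffSp.sigma X)) :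
    ∃ (i : ι) (F' : Hom DiffSp.real (X i)), F = comp (inj i) F' :=
  let g := toEuclidean (E := ℝ)
  exists_eq_inj_comp (Y := DiffSp.real)
    ⟨⇑g.symm, fun _ _ hp ↦ DiffSp.isPlot_real.2 (g.symm.contDiff.comp (DiffSp.isPlot_euc.1 hp))⟩
    ⟨⇑g, fun _ _ hp ↦ DiffSp.isPlot_euc.2 (g.contDiff.comp (DiffSp.isPlot_real.1 hp))⟩
    g.symm_apply_apply F

theorem exists_eq_inj_comp_prod {ι : Type} {X : ι → DiffSp} {n : ℕ}
    (F : Hom (DiffSp.prod (DiffSp.euc n) DiffSp.real) (DiffSp.sigma X)) :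
    ∃ (i : ι) (F' : Hom (DiffSp.prod (DiffSp.euc n) DiffSp.real) (X i)), F = comp (inj i) F' :=
  let g := toEuclidean (E := EuclideanSpace ℝ (Fin n) × ℝ)
  exists_eq_inj_comp (Y := DiffSp.prod (DiffSp.euc n) DiffSp.real)
    ⟨⇑g.symm, fun _ _ hp ↦
      DiffSp.isPlot_prod_euc_real.2 (g.symm.contDiff.comp (DiffSp.isPlot_euc.1 hp))⟩
    ⟨⇑g, fun _ _ hp ↦
      DiffSp.isPlot_euc.2 (g.contDiff.comp (DiffSp.isPlot_prod_euc_real.1 hp))⟩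
    g.symm_apply_apply F

end Hom

/-! ### Generated diffeologies -/

/-- The maps that locally belong to `G`: every point of the domain has an open neighbourhood such
that all smooth reparametrisations with values in this neighbourhood belong to `G`. -/
def LocallyIn {X : Type} (G : Set ((n : ℕ) × (EuclideanSpace ℝ (Fin n) → X))) {n : ℕ}
    (p : EuclideanSpace ℝ (Fin n) → X) : Prop :=
  ∀ x, ∃ U : Set (EuclideanSpace ℝ (Fin n)), IsOpen U ∧ x ∈ U ∧
    ∀ {m : ℕ} {f : EuclideanSpace ℝ (Fin m) → EuclideanSpace ℝ (Fin n)}, (∀ y, f y ∈ U) →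
      ContDiff ℝ ∞ f → ⟨m, p ∘ f⟩ ∈ G

namespace LocallyIn

variable {X : Type} {G : Set ((n : ℕ) × (EuclideanSpace ℝ (Fin n) → X))}

theorem of_local {n : ℕ} {p : EuclideanSpace ℝ (Fin n) → X}
    (hp : ∀ x, ∃ U : Set (EuclideanSpace ℝ (Fin n)), IsOpen U ∧ x ∈ U ∧
      ∀ {m : ℕ} {f : EuclideanSpace ℝ (Fin m) → EuclideanSpace ℝ (Fin n)}, (∀ y, f y ∈ U) →
        ContDiff ℝ ∞ f → LocallyIn G (p ∘ f)) : LocallyIn G p := by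
  intro x
  obtain ⟨U, hU, hxU, h⟩ := hp x
  obtain ⟨ε, hε, hεU⟩ := Metric.isOpen_iff.1 hU x hxU
  -- The diffeomorphism `b` from the whole space onto a ball about `x` reparametrises `p` on it.
  let b := OpenPartialHomeomorph.univBall x ε
  have htarget : b.target = Metric.ball x ε := OpenPartialHomeomorph.univBall_target x hε
  have hsource : b.source = Set.univ := OpenPartialHomeomorph.univBall_source x ε
  have hbU : ∀ y, b y ∈ U := fun y ↦ hεU (htarget ▸ b.map_source (hsource ▸ Set.mem_univ y))
  have hx : x ∈ b.target := htarget ▸ Metric.mem_ball_self hε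
  obtain ⟨V, hV, hxV, hVp⟩ := h hbU OpenPartialHomeomorph.contDiff_univBall (b.symm x)
  refine ⟨b.target ∩ b.symm ⁻¹' V, b.isOpen_inter_preimage_symm hV, ⟨hx, hxV⟩,
    fun {m f} hf hfs ↦ ?_⟩
  have hbf : ContDiff ℝ ∞ (b.symm ∘ f) := contDiffOn_univ.1 <|
    OpenPartialHomeomorph.contDiffOn_univBall_symm.comp hfs.contDiffOn
      fun y _ ↦ htarget ▸ (hf y).1
  have hpf : (p ∘ b) ∘ (b.symm ∘ f) = p ∘ f :=
    funext fun y ↦ congrArg p (b.right_inv (hf y).1)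
  exact hpf ▸ hVp (fun y ↦ (hf y).2) hbf

theorem of_isPlot_generateFrom
    (hconst : ∀ {n : ℕ} (x : X), ⟨n, fun _ ↦ x⟩ ∈ G)
    (hcomp : ∀ {n m : ℕ} {p : EuclideanSpace ℝ (Fin n) → X}
      {f : EuclideanSpace ℝ (Fin m) → EuclideanSpace ℝ (Fin n)}, ⟨n, p⟩ ∈ G → ContDiff ℝ ∞ f →
        ⟨m, p ∘ f⟩ ∈ G)
    {n : ℕ} {p : EuclideanSpace ℝ (Fin n) → X}
    (hp : @IsPlot X (DiffeologicalSpace.generateFrom G) n p) : LocallyIn G p := by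
  let d : DiffeologicalSpace X :=
    { plots _ := {p | LocallyIn G p}
      constant_plots x _ := ⟨Set.univ, isOpen_univ, Set.mem_univ _, fun _ _ ↦ hconst x⟩
      plot_reparam := fun {n m p f} hp hf x ↦ by
        obtain ⟨U, hU, hxU, h⟩ := hp (f x)
        exact ⟨f ⁻¹' U, hU.preimage hf.continuous, hxU, fun hg hgs ↦ h hg (hf.comp hgs)⟩
      locality := of_local }
  exact hp d fun _ hq _ ↦ ⟨Set.univ, isOpen_univ, Set.mem_univ _, fun _ hf ↦ hcomp hq hf⟩

end LocallyIn

/-! ### The tangent bundle -/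

/-- The point of the tangent bundle given by a smooth curve. -/
def curveTangent {X : DiffSp} (γ : Hom DiffSp.real X) : X.tangent := ⟨γ (0 : ℝ), velocity γ⟩

theorem mk_eq_curveTangent {X : DiffSp} {x : X} (γ : Curve X x) :
    (⟨x, Quotient.mk _ γ⟩ : X.tangent) = curveTangent γ.1 := by
  obtain ⟨γ, rfl⟩ := γ
  rfl

theorem mk_eq_curveTangent_out {X : DiffSp} {x : X} (v : TangentSp X x) :
    (⟨x, v⟩ : X.tangent) = curveTangent v.out.1 :=
  (congrArg (Sigma.mk x) v.out_eq.symm).trans (mk_eq_curveTangent v.out)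

theorem exists_curveTangent_eq {X : DiffSp} (v : X.tangent) : ∃ γ, curveTangent γ = v :=
  ⟨v.2.out.1, (mk_eq_curveTangent_out v.2).symm⟩

theorem curveTangent_eq_iff {X : DiffSp} {γ γ' : Hom DiffSp.real X} :
    curveTangent γ = curveTangent γ' ↔ γ (0 : ℝ) = γ' (0 : ℝ) ∧
      ∀ f : Hom X DiffSp.real, (Hom.comp f γ).deriv₀ = (Hom.comp f γ').deriv₀ := by
  constructor
  · intro h
    have h0 : γ (0 : ℝ) = γ' (0 : ℝ) := congrArg Sigma.fst h
    have h' := (mk_eq_curveTangent ⟨γ, h0⟩).trans h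
    exact ⟨h0, Quotient.exact (eq_of_heq (Sigma.mk.inj h').2)⟩
  · rintro ⟨h0, h⟩
    exact (mk_eq_curveTangent ⟨γ, h0⟩).symm.trans (congrArg (Sigma.mk _) (Quotient.sound h))

/-- The action of the tangent functor on smooth maps, as a map of the total spaces. -/
def tangentBundleMap {X Y : DiffSp} (f : Hom X Y) (v : X.tangent) : Y.tangent :=
  ⟨f v.1, TangentSp.map f v.1 v.2⟩

theorem tangentBundleMap_curveTangent {X Y : DiffSp} (f : Hom X Y) (γ : Hom DiffSp.real X) :
    tangentBundleMap f (curveTangent γ) = curveTangent (Hom.comp f γ) := rfl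

/-- The maps to the tangent bundle given by smooth families of curves: these generate the
diffeology of the tangent bundle. -/
def IsCurveFamily {X : DiffSp} {n : ℕ} (p : EuclideanSpace ℝ (Fin n) → X.tangent) : Prop :=
  ∃ F : Hom (DiffSp.prod (DiffSp.euc n) DiffSp.real) X, ∀ u : DiffSp.euc n,
    p u = curveTangent (Hom.comp F (Hom.pair (Hom.const u) (Hom.id DiffSp.real)))

namespace IsCurveFamily

variable {X : DiffSp}

theorem isPlot {n : ℕ} {p : EuclideanSpace ℝ (Fin n) → X.tangent} (hp : IsCurveFamily p) :
    IsPlot p :=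
  DiffeologicalSpace.isPlot_generatedFrom_of_mem hp

theorem const {n : ℕ} (v : X.tangent) :
    IsCurveFamily (fun _ : EuclideanSpace ℝ (Fin n) ↦ v) :=
  ⟨Hom.comp v.2.out.1 Hom.snd, fun _ ↦ mk_eq_curveTangent_out v.2⟩

theorem reparam {n m : ℕ} {p : EuclideanSpace ℝ (Fin n) → X.tangent} (hp : IsCurveFamily p)
    {f : EuclideanSpace ℝ (Fin m) → EuclideanSpace ℝ (Fin n)} (hf : ContDiff ℝ ∞ f) :
    IsCurveFamily (p ∘ f) := by
  obtain ⟨F, hF⟩ := hp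
  let f' : Hom (DiffSp.euc m) (DiffSp.euc n) := ⟨f, hf.dSmooth⟩
  exact ⟨Hom.comp F (Hom.pair (Hom.comp f' Hom.fst) Hom.snd), fun u ↦ hF (f u)⟩

theorem map {Y : DiffSp} (f : Hom X Y) {n : ℕ} {p : EuclideanSpace ℝ (Fin n) → X.tangent}
    (hp : IsCurveFamily p) : IsCurveFamily (fun u ↦ tangentBundleMap f (p u)) := by
  obtain ⟨F, hF⟩ := hp
  exact ⟨Hom.comp f F, fun u ↦ congrArg (tangentBundleMap f) (hF u)⟩

end IsCurveFamily

theorem DiffSp.locallyIn_of_isPlot_tangent {X : DiffSp} {n : ℕ}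
    {p : EuclideanSpace ℝ (Fin n) → X.tangent} (hp : IsPlot p) :
    LocallyIn {p | IsCurveFamily p.2} p :=
  LocallyIn.of_isPlot_generateFrom IsCurveFamily.const (fun hp hf ↦ IsCurveFamily.reparam hp hf) hp

theorem isPlot_of_forall_isCurveFamily {Y : Type} [DiffeologicalSpace Y] {ι : Type} [Finite ι]
    {X : ι → DiffSp} {n : ℕ} {p : ∀ i, EuclideanSpace ℝ (Fin n) → (X i).tangent}
    {q : EuclideanSpace ℝ (Fin n) → Y} (hp : ∀ i, IsPlot (p i))
    (h : ∀ {m : ℕ} {f : EuclideanSpace ℝ (Fin m) → EuclideanSpace ℝ (Fin n)}, ContDiff ℝ ∞ f →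
      (∀ i, IsCurveFamily (p i ∘ f)) → IsPlot (q ∘ f)) : IsPlot q := by
  refine DiffeologicalSpace.locality fun x ↦ ?_
  choose U hU hxU hf using fun i ↦ DiffSp.locallyIn_of_isPlot_tangent (hp i) x
  exact ⟨⋂ i, U i, isOpen_iInter_of_finite hU, Set.mem_iInter.2 hxU, fun hfU hfs ↦
    h hfs fun i ↦ hf i (fun y ↦ Set.mem_iInter.1 (hfU y) i) hfs⟩

theorem isPlot_of_isCurveFamily {Y : Type} [DiffeologicalSpace Y] {X : DiffSp} {n : ℕ}
    {p : EuclideanSpace ℝ (Fin n) → X.tangent} {q : EuclideanSpace ℝ (Fin n) → Y} (hp : IsPlot p)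
    (h : ∀ {m : ℕ} {f : EuclideanSpace ℝ (Fin m) → EuclideanSpace ℝ (Fin n)}, ContDiff ℝ ∞ f →
      IsCurveFamily (p ∘ f) → IsPlot (q ∘ f)) : IsPlot q :=
  isPlot_of_forall_isCurveFamily (ι := Unit) (fun _ ↦ hp) fun hf hpf ↦ h hf (hpf ())

theorem dSmooth_tangentBundleMap {X Y : DiffSp} (f : Hom X Y) : DSmooth (tangentBundleMap f) :=
  fun _ _ hp ↦ isPlot_of_isCurveFamily hp fun _ hpf ↦ (hpf.map f).isPlot

/-! ### The fibre powers of the tangent bundle -/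

/-- The `j`-th tangent vector of a point of the fibre power of the tangent bundle. -/
def DiffSp.tangentPowProj {k : ℕ} {X : DiffSp} (j : Fin k) (v : X.tangentPow k) : X.tangent :=
  ⟨v.1, v.2 j⟩

open DiffSp (tangentPowProj)

theorem DiffSp.tangentPow_ext {k : ℕ} {X : DiffSp} {v w : X.tangentPow k} (h : v.1 = w.1)
    (hj : ∀ j, tangentPowProj j v = tangentPowProj j w) : v = w := by
  obtain ⟨x, v⟩ := v
  obtain ⟨y, w⟩ := w
  obtain rfl : x = y := h
  exact congrArg (Sigma.mk x) (funext fun j ↦ eq_of_heq (Sigma.mk.inj (hj j)).2)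

theorem DiffSp.isPlot_tangentPow {k : ℕ} {X : DiffSp} {n : ℕ}
    {p : EuclideanSpace ℝ (Fin n) → X.tangentPow k} :
    IsPlot p ↔ IsPlot (fun u ↦ (p u).1) ∧ ∀ j, IsPlot (fun u ↦ tangentPowProj j (p u)) :=
  DiffeologicalSpace.isPlot_inf_iff.trans
    (and_congr Iff.rfl DiffeologicalSpace.isPlot_iInf_iff)

theorem dSmooth_tangentMap (k : ℕ) {X Y : DiffSp} (f : Hom X Y) :
    DSmooth (tangentMap k f) := fun n _ hp ↦
  DiffSp.isPlot_tangentPow.2 ⟨f.smooth n _ (DiffSp.isPlot_tangentPow.1 hp).1,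
    fun j ↦ dSmooth_tangentBundleMap f n _ ((DiffSp.isPlot_tangentPow.1 hp).2 j)⟩

/-! ### Tangent bundles of products -/

theorem deriv_diagonal_eq_sum {ι F : Type*} [Fintype ι] [DecidableEq ι] [NormedAddCommGroup F]
    [NormedSpace ℝ F] {G : EuclideanSpace ℝ ι → F} (hG : DifferentiableAt ℝ G 0) :
    deriv (fun t : ℝ ↦ G (WithLp.toLp 2 fun _ ↦ t)) 0 =
      ∑ i, deriv (fun t : ℝ ↦ G (EuclideanSpace.single i t)) 0 := by
  have hline (v : EuclideanSpace ℝ ι) : deriv (fun t : ℝ ↦ G (t • v)) 0 = fderiv ℝ G 0 v := by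
    have hv : HasDerivAt (fun t : ℝ ↦ t • v) v 0 := by
      simpa using (hasDerivAt_id (0 : ℝ)).smul_const v
    have hG' : HasFDerivAt G (fderiv ℝ G 0) ((0 : ℝ) • v) := (zero_smul ℝ v).symm ▸ hG.hasFDerivAt
    exact (hG'.comp_hasDerivAt (0 : ℝ) hv).deriv
  have hsingle (i : ι) (t : ℝ) : t • EuclideanSpace.single i (1 : ℝ) =
      EuclideanSpace.single i t := by
    ext l
    simp
  have hdiag : (WithLp.toLp 2 fun _ ↦ 1 : EuclideanSpace ℝ ι) =
      ∑ i, EuclideanSpace.single i 1 := by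
    ext l
    simp [Pi.single_apply]
  calc deriv (fun t : ℝ ↦ G (WithLp.toLp 2 fun _ ↦ t)) 0
      = deriv (fun t : ℝ ↦ G (t • WithLp.toLp 2 fun _ ↦ 1)) 0 := by
        simp only [← WithLp.toLp_smul, Pi.smul_def, smul_eq_mul, mul_one]
    _ = ∑ i, fderiv ℝ G 0 (EuclideanSpace.single i 1) := by rw [hline, hdiag, map_sum]
    _ = ∑ i, deriv (fun t : ℝ ↦ G (EuclideanSpace.single i t)) 0 := by
        simp only [← hline, hsingle]

/-- The inclusion of the `i`-th factor into a product as the slice through the point `x`. -/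
def Hom.slice {ι : Type} [DecidableEq ι] {X : ι → DiffSp} (x : DiffSp.pi X) (i : ι) :
    Hom (X i) (DiffSp.pi X) :=
  Hom.piLift (Function.update (fun l ↦ Hom.const (x l)) i (Hom.id (X i)))

theorem Hom.slice_apply {ι : Type} [DecidableEq ι] {X : ι → DiffSp} (x : DiffSp.pi X) (i : ι)
    (y : X i) : Hom.slice x i y = Function.update x i y := by
  funext l
  obtain rfl | hl := eq_or_ne l i
  · simpa [slice, piLift, id] using (Function.update_self l y x).symm
  · simpa [slice, piLift, const, hl] using (Function.update_of_ne hl y x).symm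

theorem Hom.deriv₀_comp_pi {n : ℕ} {X : Fin n → DiffSp} (f : Hom (DiffSp.pi X) DiffSp.real)
    (γ : Hom DiffSp.real (DiffSp.pi X)) :
    (comp f γ).deriv₀ =
      ∑ i, (comp f (comp (slice (γ (0 : ℝ)) i) (comp (piProj i) γ))).deriv₀ := by
  let G : EuclideanSpace ℝ (Fin n) → ℝ := fun s ↦ f fun i ↦ γ (s i) i
  have hG : ContDiff ℝ ∞ G := f.smooth n _ (DiffSp.isPlot_pi.2 fun i ↦
    (comp (piProj i) γ).smooth n (fun s ↦ (s i : ℝ)) (ContDiff.isPlot (X := ℝ) (by fun_prop)))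
  refine (deriv_diagonal_eq_sum (hG.differentiable (by simp) 0)).trans
    (Finset.sum_congr rfl fun i _ ↦ ?_)
  refine congrArg (fun g : ℝ → ℝ ↦ deriv g 0) (funext fun t ↦ congrArg f.toFun ?_)
  refine Eq.trans (funext fun l ↦ ?_) (slice_apply _ i _).symm
  obtain rfl | hl := eq_or_ne l i
  · exact (congrArg (fun s : ℝ ↦ γ s l) (by simp)).trans
      (Function.update_self l (γ t l) (γ (0 : ℝ))).symm
  · exact (congrArg (fun s : ℝ ↦ γ s l) (by simp [hl])).trans
      (Function.update_of_ne hl (γ t i) (γ (0 : ℝ))).symm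

theorem DiffSp.tangent_pi_ext {n : ℕ} {X : Fin n → DiffSp} {v w : (DiffSp.pi X).tangent}
    (h : ∀ i, tangentBundleMap (Hom.piProj i) v = tangentBundleMap (Hom.piProj i) w) : v = w := by
  obtain ⟨γ, rfl⟩ := exists_curveTangent_eq v
  obtain ⟨γ', rfl⟩ := exists_curveTangent_eq w
  have h0 : γ (0 : ℝ) = γ' (0 : ℝ) := funext fun i ↦ congrArg Sigma.fst (h i)
  have hi (i : Fin n) := curveTangent_eq_iff.1
    (show curveTangent (Hom.comp (Hom.piProj i) γ) = curveTangent (Hom.comp (Hom.piProj i) γ')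
      from h i)
  refine curveTangent_eq_iff.2 ⟨h0, fun f ↦ ?_⟩
  rw [Hom.deriv₀_comp_pi, Hom.deriv₀_comp_pi, ← h0]
  exact Finset.sum_congr rfl fun i _ ↦ (hi i).2 (Hom.comp f (Hom.slice (γ (0 : ℝ)) i))

theorem DiffSp.tangent_prod_ext {X Y : DiffSp} {v w : (DiffSp.prod X Y).tangent}
    (h₁ : tangentBundleMap Hom.fst v = tangentBundleMap Hom.fst w)
    (h₂ : tangentBundleMap Hom.snd v = tangentBundleMap Hom.snd w) : v = w := by
  obtain ⟨γ, rfl⟩ := exists_curveTangent_eq v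
  obtain ⟨γ', rfl⟩ := exists_curveTangent_eq w
  let Z : Fin 2 → DiffSp := ![X, Y]
  let toPi : Hom (DiffSp.prod X Y) (DiffSp.pi Z) :=
    Hom.piLift (Fin.cases Hom.fst (Fin.cases Hom.snd finZeroElim))
  let ofPi : Hom (DiffSp.pi Z) (DiffSp.prod X Y) :=
    Hom.pair (Hom.piProj (X := Z) 0) (Hom.piProj (X := Z) 1)
  have h : tangentBundleMap toPi (curveTangent γ) = tangentBundleMap toPi (curveTangent γ') :=
    DiffSp.tangent_pi_ext (Fin.cases h₁ (Fin.cases h₂ finZeroElim))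
  exact congrArg (tangentBundleMap ofPi) h

theorem DiffSp.tangentPow_pi_ext {k n : ℕ} {X : Fin n → DiffSp} {v w : (DiffSp.pi X).tangentPow k}
    (h : ∀ i, tangentMap k (Hom.piProj i) v = tangentMap k (Hom.piProj i) w) : v = w :=
  DiffSp.tangentPow_ext (funext fun i ↦ congrArg Sigma.fst (h i)) fun j ↦
    DiffSp.tangent_pi_ext fun i ↦ congrArg (tangentPowProj j) (h i)

theorem DiffSp.tangentPow_prod_ext {k : ℕ} {X Y : DiffSp} {v w : (DiffSp.prod X Y).tangentPow k}
    (h₁ : tangentMap k Hom.fst v = tangentMap k Hom.fst w)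
    (h₂ : tangentMap k Hom.snd v = tangentMap k Hom.snd w) : v = w :=
  DiffSp.tangentPow_ext (Prod.ext (congrArg Sigma.fst h₁) (congrArg Sigma.fst h₂)) fun j ↦
    DiffSp.tangent_prod_ext (congrArg (tangentPowProj j) h₁) (congrArg (tangentPowProj j) h₂)

theorem tangentPowProj_tangentPi {k n : ℕ} {X : Fin n → DiffSp} {v : ∀ i, (X i).tangentPow k}
    {j : Fin k} {γ : ∀ i, Hom DiffSp.real (X i)}
    (h : ∀ i, tangentPowProj j (v i) = curveTangent (γ i)) :
    tangentPowProj j (tangentPi k v) = curveTangent (Hom.piLift γ) :=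
  DiffSp.tangent_pi_ext fun i ↦
    (congrArg (tangentPowProj j) (tangentMap_tangentPi k v i)).trans (h i)

theorem tangentMap_fst_tangentProd {k : ℕ} {X Y : DiffSp} (v : X.tangentPow k)
    (w : Y.tangentPow k) : tangentMap k Hom.fst (tangentProd k v w) = v :=
  Sigma.ext rfl (heq_of_eq (funext fun j ↦ (v.2 j).out_eq))

theorem tangentMap_snd_tangentProd {k : ℕ} {X Y : DiffSp} (v : X.tangentPow k)
    (w : Y.tangentPow k) : tangentMap k Hom.snd (tangentProd k v w) = w :=
  Sigma.ext rfl (heq_of_eq (funext fun j ↦ (w.2 j).out_eq))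

theorem tangentPowProj_tangentProd {k : ℕ} {X Y : DiffSp} {v : X.tangentPow k}
    {w : Y.tangentPow k} {j : Fin k} {γ : Hom DiffSp.real X} {δ : Hom DiffSp.real Y}
    (hv : tangentPowProj j v = curveTangent γ) (hw : tangentPowProj j w = curveTangent δ) :
    tangentPowProj j (tangentProd k v w) = curveTangent (Hom.pair γ δ) :=
  DiffSp.tangent_prod_ext
    ((congrArg (tangentPowProj j) (tangentMap_fst_tangentProd v w)).trans hv)
    ((congrArg (tangentPowProj j) (tangentMap_snd_tangentProd v w)).trans hw)

theorem dSmooth_tangentPi (k : ℕ) {n : ℕ} (X : Fin n → DiffSp) :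
    DSmooth (X := DiffSp.pi fun i ↦ (X i).tangentPow k) (tangentPi k (X := X)) := by
  intro m p hp
  have hp' (i : Fin n) := DiffSp.isPlot_tangentPow.1 (DiffSp.isPlot_pi.1 hp i)
  refine DiffSp.isPlot_tangentPow.2 ⟨DiffSp.isPlot_pi.2 fun i ↦ (hp' i).1, fun j ↦ ?_⟩
  refine isPlot_of_forall_isCurveFamily (fun i ↦ (hp' i).2 j) fun _ hF ↦ ?_
  choose F hF using hF
  exact IsCurveFamily.isPlot ⟨Hom.piLift F, fun u ↦ tangentPowProj_tangentPi fun i ↦ hF i u⟩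

theorem dSmooth_tangentProd (k : ℕ) (X Y : DiffSp) :
    DSmooth (X := DiffSp.prod (X.tangentPow k) (Y.tangentPow k))
      (fun v ↦ tangentProd k v.1 v.2) := by
  intro m p hp
  have hp₁ := DiffSp.isPlot_tangentPow.1 (DiffSp.isPlot_prod.1 hp).1
  have hp₂ := DiffSp.isPlot_tangentPow.1 (DiffSp.isPlot_prod.1 hp).2
  refine DiffSp.isPlot_tangentPow.2 ⟨DiffSp.isPlot_prod.2 ⟨hp₁.1, hp₂.1⟩, fun j ↦ ?_⟩
  refine isPlot_of_isCurveFamily (hp₁.2 j) fun hf hF ↦ ?_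
  refine isPlot_of_isCurveFamily (DiffeologicalSpace.plot_reparam (hp₂.2 j) hf) fun hg hG ↦ ?_
  obtain ⟨F, hF⟩ := hF.reparam hg
  obtain ⟨G, hG⟩ := hG
  exact IsCurveFamily.isPlot ⟨Hom.pair F G, fun u ↦ tangentPowProj_tangentProd (hF u) (hG u)⟩

theorem isDiffeo_tangentPi (k : ℕ) {n : ℕ} (X : Fin n → DiffSp) :
    IsDiffeo (X := DiffSp.pi fun i ↦ (X i).tangentPow k) (tangentPi k (X := X)) :=
  ⟨dSmooth_tangentPi k X, fun v i ↦ tangentMap k (Hom.piProj i) v,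
    fun m p hp ↦ DiffSp.isPlot_pi.2 fun i ↦ dSmooth_tangentMap k (Hom.piProj i) m p hp,
    fun v ↦ funext (tangentMap_tangentPi k v),
    fun _ ↦ DiffSp.tangentPow_pi_ext (tangentMap_tangentPi k _)⟩

theorem isDiffeo_tangentProd (k : ℕ) (X Y : DiffSp) :
    IsDiffeo (X := DiffSp.prod (X.tangentPow k) (Y.tangentPow k))
      (fun v ↦ tangentProd k v.1 v.2) :=
  ⟨dSmooth_tangentProd k X Y, fun v ↦ (tangentMap k Hom.fst v, tangentMap k Hom.snd v),
    fun m p hp ↦ DiffSp.isPlot_prod.2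
      ⟨dSmooth_tangentMap k Hom.fst m p hp, dSmooth_tangentMap k Hom.snd m p hp⟩,
    fun v ↦ Prod.ext (tangentMap_fst_tangentProd v.1 v.2) (tangentMap_snd_tangentProd v.1 v.2),
    fun _ ↦ DiffSp.tangentPow_prod_ext (tangentMap_fst_tangentProd _ _)
      (tangentMap_snd_tangentProd _ _)⟩

/-! ### Tangent bundles of disjoint unions -/

theorem Hom.exists_comp_inj_eq {ι : Type} {X : ι → DiffSp} {Y : DiffSp} [Nonempty Y] (i : ι)
    (f : Hom (X i) Y) : ∃ g : Hom (DiffSp.sigma X) Y, comp g (inj i) = f := by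
  classical
  let y : Y := Classical.arbitrary Y
  let g : Hom (DiffSp.sigma X) Y := comp (case (E := DiffSp.unit) fun l ↦
    if hl : l = i then comp (hl ▸ f) fst else const y) (pair (id _) toUnit)
  refine ⟨g, Hom.ext (funext fun x ↦ ?_)⟩
  simp [g, comp, case, inj, pair, id, fst]

theorem tangentBundleMap_inj_injective {ι : Type} {X : ι → DiffSp} (i : ι) :
    Function.Injective (tangentBundleMap (Hom.inj (X := X) i)) := by
  intro v w h
  obtain ⟨γ, rfl⟩ := exists_curveTangent_eq v
  obtain ⟨γ', rfl⟩ := exists_curveTangent_eq w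
  rw [tangentBundleMap_curveTangent, tangentBundleMap_curveTangent] at h
  obtain ⟨h0, h⟩ := curveTangent_eq_iff.1 h
  refine curveTangent_eq_iff.2 ⟨eq_of_heq (Sigma.mk.inj h0).2, fun f ↦ ?_⟩
  have : Nonempty DiffSp.real := ⟨(0 : ℝ)⟩
  obtain ⟨g, rfl⟩ := Hom.exists_comp_inj_eq i f
  exact h g

theorem tangentMap_inj_injective (k : ℕ) {ι : Type} {X : ι → DiffSp} (i : ι) :
    Function.Injective (tangentMap k (Hom.inj (X := X) i)) := fun _ _ h ↦
  DiffSp.tangentPow_ext (eq_of_heq (Sigma.mk.inj (congrArg Sigma.fst h)).2) fun j ↦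
    tangentBundleMap_inj_injective i (congrArg (tangentPowProj j) h)

theorem exists_tangentBundleMap_inj_eq {ι : Type} {X : ι → DiffSp} {i : ι} {x : X i}
    (v : TangentSp (DiffSp.sigma X) ⟨i, x⟩) :
    ∃ w : TangentSp (X i) x, tangentBundleMap (Hom.inj i) ⟨x, w⟩ = ⟨⟨i, x⟩, v⟩ := by
  obtain ⟨⟨γ, hγ⟩, rfl⟩ := Quotient.exists_rep v
  obtain ⟨l, γ', rfl⟩ := γ.exists_eq_inj_comp_real
  obtain rfl : l = i := congrArg Sigma.fst hγ
  obtain rfl : γ' (0 : ℝ) = x := eq_of_heq (Sigma.mk.inj hγ).2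
  exact ⟨velocity γ', rfl⟩

theorem exists_tangentMap_inj_eq {k : ℕ} {ι : Type} {X : ι → DiffSp} {i : ι}
    (v : (DiffSp.sigma X).tangentPow k) (hi : v.1.1 = i) :
    ∃ w : (X i).tangentPow k, tangentMap k (Hom.inj i) w = v := by
  obtain ⟨⟨l, x⟩, v⟩ := v
  obtain rfl : l = i := hi
  choose w hw using fun j ↦ exists_tangentBundleMap_inj_eq (v j)
  exact ⟨⟨x, w⟩, DiffSp.tangentPow_ext rfl hw⟩

theorem DiffSp.isPlot_of_isPlot_inj {ι : Type} {X : ι → DiffSp} {i : ι} {n : ℕ}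
    {p : EuclideanSpace ℝ (Fin n) → X i} (hp : IsPlot fun u ↦ Hom.inj (X := X) i (p u)) :
    IsPlot p := by
  obtain ⟨l, q, hq, hpq⟩ := hp
  have h (u : EuclideanSpace ℝ (Fin n)) : (⟨i, p u⟩ : Σ i, X i) = ⟨l, q u⟩ := congrFun hpq u
  obtain rfl : i = l := congrArg Sigma.fst (h 0)
  obtain rfl : p = q := funext fun u ↦ eq_of_heq (Sigma.mk.inj (h u)).2
  exact hq

theorem isPlot_of_isPlot_tangentBundleMap_inj {ι : Type} {X : ι → DiffSp} {i : ι} {n : ℕ}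
    {p : EuclideanSpace ℝ (Fin n) → (X i).tangent}
    (hp : IsPlot fun u ↦ tangentBundleMap (Hom.inj (X := X) i) (p u)) : IsPlot p := by
  refine isPlot_of_isCurveFamily hp fun _ ⟨F, hF⟩ ↦ ?_
  obtain ⟨l, F, rfl⟩ := F.exists_eq_inj_comp_prod
  obtain rfl : i = l := congrArg (fun v : (DiffSp.sigma X).tangent ↦ v.1.1)
    (hF (0 : EuclideanSpace ℝ _))
  exact IsCurveFamily.isPlot ⟨F, fun u ↦ tangentBundleMap_inj_injective i (hF u)⟩

theorem isPlot_of_isPlot_tangentMap_inj {k : ℕ} {ι : Type} {X : ι → DiffSp} {i : ι} {n : ℕ}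
    {p : EuclideanSpace ℝ (Fin n) → (X i).tangentPow k}
    (hp : IsPlot fun u ↦ tangentMap k (Hom.inj (X := X) i) (p u)) : IsPlot p :=
  DiffSp.isPlot_tangentPow.2 ⟨DiffSp.isPlot_of_isPlot_inj (DiffSp.isPlot_tangentPow.1 hp).1,
    fun j ↦ isPlot_of_isPlot_tangentBundleMap_inj ((DiffSp.isPlot_tangentPow.1 hp).2 j)⟩

theorem isDiffeo_tangentSigma (k : ℕ) {ι : Type} (X : ι → DiffSp) :
    IsDiffeo (X := DiffSp.sigma fun i ↦ (X i).tangentPow k)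
      (fun v ↦ tangentMap k (Hom.inj (X := X) v.1) v.2) := by
  refine IsDiffeo.of_lift ?_ ?_ fun n p hp ↦ ?_
  · rintro n _ ⟨i, q, hq, rfl⟩
    exact dSmooth_tangentMap k (Hom.inj i) n q hq
  · rintro ⟨i, v⟩ ⟨l, w⟩ h
    obtain rfl : i = l := congrArg (fun v : (DiffSp.sigma X).tangentPow k ↦ v.1.1) h
    exact congrArg (Sigma.mk i) (tangentMap_inj_injective k i h)
  · obtain ⟨i, q, -, hpq⟩ := (DiffSp.isPlot_tangentPow.1 hp).1
    choose w hw using fun u ↦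
      exists_tangentMap_inj_eq (p u) (congrArg Sigma.fst (congrFun hpq u))
    obtain rfl : (fun u ↦ tangentMap k (Hom.inj i) (w u)) = p := funext hw
    exact ⟨fun u ↦ ⟨i, w u⟩, ⟨i, w, isPlot_of_isPlot_tangentMap_inj hp, rfl⟩, fun _ ↦ rfl⟩

/-! ### The tangent bundle of the reals -/

theorem Hom.deriv₀_comp (f γ : Hom DiffSp.real DiffSp.real) :
    (comp f γ).deriv₀ = deriv (F := ℝ) (fun x : ℝ ↦ f x) (γ (0 : ℝ)) * γ.deriv₀ :=
  ((f.contDiff_real.differentiable (by simp) _).hasDerivAt.comp (0 : ℝ) γ.hasDerivAt_deriv₀).deriv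

theorem curveTangent_real_eq_iff {γ γ' : Hom DiffSp.real DiffSp.real} :
    curveTangent γ = curveTangent γ' ↔ γ (0 : ℝ) = γ' (0 : ℝ) ∧ γ.deriv₀ = γ'.deriv₀ := by
  rw [curveTangent_eq_iff]
  refine and_congr_right fun h0 ↦ ⟨fun h ↦ h (Hom.id _), fun h f ↦ ?_⟩
  rw [Hom.deriv₀_comp, Hom.deriv₀_comp, h0, h]

theorem deriv₀_line (a b : ℝ) : (line a b).deriv₀ = b := by
  have h : HasDerivAt (fun t : ℝ ↦ a + b * t) (b * 1) 0 :=
    ((hasDerivAt_id (0 : ℝ)).const_mul b).const_add a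
  exact h.deriv.trans (mul_one b)

theorem tangentPowProj_tangentReal {k : ℕ} {x : ℝ} {x' : Fin k → ℝ} {j : Fin k}
    {γ : Hom DiffSp.real DiffSp.real} :
    tangentPowProj j (tangentReal k x x') = curveTangent γ ↔
      x = γ (0 : ℝ) ∧ x' j = γ.deriv₀ := by
  have hline : tangentPowProj j (tangentReal k x x') = curveTangent (line x (x' j)) :=
    mk_eq_curveTangent _
  have h0 : line x (x' j) (0 : ℝ) = x := show x + x' j * 0 = x by simp
  rw [hline, curveTangent_real_eq_iff, h0, deriv₀_line]
  exact Iff.rfl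

theorem contDiff_deriv₀ {n : ℕ} (F : Hom (DiffSp.prod (DiffSp.euc n) DiffSp.real) DiffSp.real) :
    ContDiff ℝ ∞ (fun u : EuclideanSpace ℝ (Fin n) ↦ (Hom.comp F
      (Hom.pair (Hom.const (Y := DiffSp.euc n) u) (Hom.id DiffSp.real))).deriv₀) := by
  let G : EuclideanSpace ℝ (Fin n) × ℝ → ℝ := F.toFun
  have hG : ContDiff ℝ ∞ G := F.contDiff_prod
  have hG' : ContDiff ℝ ∞ (fun u : EuclideanSpace ℝ (Fin n) ↦ fderiv ℝ G (u, 0) (0, 1)) :=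
    ((hG.fderiv_right (by simp)).comp (contDiff_id.prodMk contDiff_const)).clm_apply
      contDiff_const
  have hderiv (u : EuclideanSpace ℝ (Fin n)) :
      deriv (fun t : ℝ ↦ G (u, t)) 0 = fderiv ℝ G (u, 0) (0, 1) :=
    ((hG.differentiable (by simp) (u, 0)).hasFDerivAt.comp_hasDerivAt (0 : ℝ)
      ((hasDerivAt_const (0 : ℝ) u).prodMk (hasDerivAt_id (0 : ℝ)))).deriv
  exact (funext hderiv : (fun u ↦ deriv (fun t : ℝ ↦ G (u, t)) 0) = _) ▸ hG'

/-- The coordinate of a tangent vector of the real line. -/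
def slope (v : DiffSp.real.tangent) : ℝ :=
  Quotient.lift (fun γ ↦ γ.1.deriv₀)
    (fun _ _ (h : (Curve.setoid DiffSp.real v.1).r _ _) ↦ h (Hom.id _)) v.2

theorem dSmooth_slope : DSmooth (Y := DiffSp.real) slope := fun _ _ hp ↦
  isPlot_of_isCurveFamily hp fun _ ⟨F, hF⟩ ↦
    (funext fun u ↦ congrArg slope (hF u) : slope ∘ _ = _) ▸
      DiffSp.isPlot_real.2 (contDiff_deriv₀ F)

theorem dSmooth_tangentReal (k : ℕ) :
    DSmooth (X := DiffSp.prod DiffSp.real (DiffSp.pi fun _ : Fin k ↦ DiffSp.real))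
      (fun d ↦ tangentReal k d.1 d.2) := by
  intro n p hp
  obtain ⟨hp₁, hp₂⟩ := DiffSp.isPlot_prod.1 hp
  refine DiffSp.isPlot_tangentPow.2 ⟨hp₁, fun j ↦ IsCurveFamily.isPlot ?_⟩
  let x : Hom (DiffSp.euc n) DiffSp.real := ⟨fun u ↦ (p u).1, hp₁.dSmooth⟩
  let x' : Hom (DiffSp.euc n) DiffSp.real :=
    ⟨fun u ↦ (p u).2 j, (DiffSp.isPlot_pi.1 hp₂ j).dSmooth⟩
  exact ⟨Hom.add (Hom.comp x Hom.fst) (Hom.mul (Hom.comp x' Hom.fst) Hom.snd),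
    fun _ ↦ mk_eq_curveTangent _⟩

theorem isDiffeo_tangentReal (k : ℕ) :
    IsDiffeo (X := DiffSp.prod DiffSp.real (DiffSp.pi fun _ : Fin k ↦ DiffSp.real))
      (fun d ↦ tangentReal k d.1 d.2) := by
  refine ⟨dSmooth_tangentReal k, fun v ↦ (v.1, fun j ↦ slope (tangentPowProj j v)),
    fun n p hp ↦ DiffSp.isPlot_prod.2 ⟨(DiffSp.isPlot_tangentPow.1 hp).1,
      DiffSp.isPlot_pi.2 fun j ↦ dSmooth_slope n _ ((DiffSp.isPlot_tangentPow.1 hp).2 j)⟩,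
    fun d ↦ Prod.ext rfl (funext fun j ↦ deriv₀_line d.1 (d.2 j)),
    fun v ↦ DiffSp.tangentPow_ext rfl fun j ↦ ?_⟩
  obtain ⟨γ, hγ⟩ := exists_curveTangent_eq (tangentPowProj j v)
  exact (tangentPowProj_tangentReal.2
    ⟨(congrArg Sigma.fst hγ).symm, congrArg slope hγ.symm⟩).trans hγ

/-! ### The canonical isomorphisms -/

theorem isDiffeo_pi_fin_two (X : Fin 2 → DiffSp) :
    IsDiffeo (X := DiffSp.pi X) (Y := DiffSp.prod (X 0) (X 1)) (fun x ↦ (x 0, x 1)) :=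
  ⟨fun _ _ hp ↦ DiffSp.isPlot_prod.2 ⟨DiffSp.isPlot_pi.1 hp 0, DiffSp.isPlot_pi.1 hp 1⟩,
    fun x ↦ Fin.cases x.1 (Fin.cases x.2 finZeroElim),
    fun _ _ hp ↦ DiffSp.isPlot_pi.2 <| Fin.cases (DiffSp.isPlot_prod.1 hp).1
      (Fin.cases (DiffSp.isPlot_prod.1 hp).2 finZeroElim),
    fun _ ↦ funext (Fin.cases rfl (Fin.cases rfl finZeroElim)), fun _ ↦ rfl⟩

theorem Ty.isDiffeo_toTangent (k : ℕ) : ∀ (τ : Ty) (h : τ.FirstOrder), IsDiffeo (τ.toTangent k h)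
  | .real, _ => (isDiffeo_tangentReal k).comp
      (isDiffeo_pi_fin_two fun i ↦ ((![.real, .vec k] : Fin 2 → Ty) i).sem)
  | .prod _ σ, h => (isDiffeo_tangentPi k fun i ↦ (σ i).sem).comp
      (IsDiffeo.piMap fun i ↦ (σ i).isDiffeo_toTangent k (h i))
  | .fn _ _, h => h.elim
  | .variant _ σ, h => (isDiffeo_tangentSigma k fun i ↦ (σ i).sem).comp
      (IsDiffeo.sigmaMap fun i ↦ (σ i).isDiffeo_toTangent k (h i))
  | .list σ, h => (isDiffeo_tangentSigma k fun m : ℕ ↦ DiffSp.pi fun _ : Fin m ↦ σ.sem).comp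
      (IsDiffeo.sigmaMap fun m : ℕ ↦ (isDiffeo_tangentPi k fun _ : Fin m ↦ σ.sem).comp
        (IsDiffeo.piMap fun _ ↦ σ.isDiffeo_toTangent k h))

theorem Ctx.isDiffeo_toTangent (k : ℕ) :
    ∀ (Γ : Ctx) (h : Γ.FirstOrder), IsDiffeo (Γ.toTangent k h)
  | [], _ => by
    refine ⟨fun _ _ _ ↦ DiffeologicalSpace.constant_plots _, fun _ ↦ (),
      fun _ _ _ ↦ DiffSp.isPlot_unit _, fun _ ↦ rfl, fun v ↦ DiffSp.tangentPow_ext rfl fun j ↦ ?_⟩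
    obtain ⟨_, hγ⟩ := exists_curveTangent_eq (tangentPowProj j v)
    exact (mk_eq_curveTangent _).trans hγ
  | σ :: Γ, h => (isDiffeo_tangentProd k σ.sem (Ctx.sem Γ)).comp
      ((σ.isDiffeo_toTangent k _).prodMap (Ctx.isDiffeo_toTangent k Γ _))

/-! ### Correctness at first order types -/

/-- The curve `γ` represents the base point of `v` and, for `j ∈ J`, its `j`-th tangent vector. -/
def Represents {k : ℕ} (J : Set (Fin k)) {X : DiffSp} (γ : Hom DiffSp.real X)
    (v : X.tangentPow k) : Prop :=
  v.1 = γ (0 : ℝ) ∧ ∀ j ∈ J, tangentPowProj j v = curveTangent γ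

namespace Represents

variable {k : ℕ} {J : Set (Fin k)}

theorem map {X Y : DiffSp} (f : Hom X Y) {γ : Hom DiffSp.real X} {v : X.tangentPow k}
    (h : Represents J γ v) : Represents J (Hom.comp f γ) (tangentMap k f v) :=
  ⟨congrArg f.toFun h.1, fun j hj ↦ congrArg (tangentBundleMap f) (h.2 j hj)⟩

theorem proj {n : ℕ} {X : Fin n → DiffSp} {γ : Hom DiffSp.real (DiffSp.pi X)}
    {v : ∀ i, (X i).tangentPow k} (h : Represents J γ (tangentPi k v)) (i : Fin n) :
    Represents J (Hom.comp (Hom.piProj i) γ) (v i) :=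
  tangentMap_tangentPi k v i ▸ h.map (Hom.piProj i)

theorem pi {n : ℕ} {X : Fin n → DiffSp} {γ : ∀ i, Hom DiffSp.real (X i)}
    {v : ∀ i, (X i).tangentPow k} (h : ∀ i, Represents J (γ i) (v i)) :
    Represents J (Hom.piLift γ) (tangentPi k v) :=
  ⟨funext fun i ↦ (h i).1, fun j hj ↦ tangentPowProj_tangentPi fun i ↦ (h i).2 j hj⟩

theorem fst {X Y : DiffSp} {γ : Hom DiffSp.real (DiffSp.prod X Y)} {v : X.tangentPow k}
    {w : Y.tangentPow k} (h : Represents J γ (tangentProd k v w)) :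
    Represents J (Hom.comp Hom.fst γ) v :=
  tangentMap_fst_tangentProd v w ▸ h.map Hom.fst

theorem snd {X Y : DiffSp} {γ : Hom DiffSp.real (DiffSp.prod X Y)} {v : X.tangentPow k}
    {w : Y.tangentPow k} (h : Represents J γ (tangentProd k v w)) :
    Represents J (Hom.comp Hom.snd γ) w :=
  tangentMap_snd_tangentProd v w ▸ h.map Hom.snd

theorem exists_inj {ι : Type} {X : ι → DiffSp} {i : ι} {γ : Hom DiffSp.real (DiffSp.sigma X)}
    {v : (X i).tangentPow k} (h : Represents J γ (tangentMap k (Hom.inj i) v)) :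
    ∃ γ' : Hom DiffSp.real (X i), γ = Hom.comp (Hom.inj i) γ' ∧ Represents J γ' v := by
  obtain ⟨l, γ', rfl⟩ := γ.exists_eq_inj_comp_real
  have h0 : (⟨i, v.1⟩ : Σ i, X i) = ⟨l, γ' (0 : ℝ)⟩ := h.1
  obtain rfl : i = l := congrArg Sigma.fst h0
  exact ⟨γ', rfl, eq_of_heq (Sigma.mk.inj h0).2,
    fun j hj ↦ tangentBundleMap_inj_injective i (h.2 j hj)⟩

end Represents

namespace Tm

theorem sem_mapTuple {Γ : Ctx} {n : ℕ} {σ τ : Fin n → Ty}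
    (t : ∀ i, Tm (Ctx.ext (Ty.prod n σ :: Γ) n σ) (Ty.fn (σ i) (τ i))) (d : Γ.sem)
    (e : (Ty.prod n σ).sem) :
    Hom.toFun ((lam (letTuple v0 (.tuple fun i ↦ .app (t i) (.var (.bound n σ i))))).sem d) e =
      fun i ↦ Hom.toFun ((t i).sem (Ctx.extend (Ctx.cons e d) n σ e)) (e i) :=
  (sem_letTuple v0 (.tuple fun i ↦ .app (t i) (.var (.bound n σ i))) (Ctx.cons e d)).trans <|
    funext fun i ↦ congrArg (Hom.toFun _) (Var.sem_bound_extend _ n _ _ i)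

theorem exists_foldAux_mapList {Γ : Ctx} {σ τ : Ty}
    (t : Tm (Ty.list τ :: σ :: Γ) (Ty.fn σ τ)) (d : Γ.sem) (m : ℕ) (v : Fin m → σ.sem) :
    ∃ l : Fin m → τ.sem, Hom.foldAux (cons (.app t v1) v0).sem nil.sem d m v = ⟨m, l⟩ ∧
      ∀ i, ∃ d', l i = Hom.toFun (t.sem d') (v i) := by
  induction m with
  | zero =>
    exact ⟨fun i ↦ i.elim0, congrArg (Sigma.mk 0) (funext fun i ↦ i.elim0), fun i ↦ i.elim0⟩
  | succ m ih =>
    obtain ⟨l, hl, hl'⟩ := ih fun i ↦ v i.succ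
    let head := Hom.toFun (t.sem (Ctx.cons (σ := .list τ) ⟨m, l⟩ (Ctx.cons (v 0) d))) (v 0)
    refine ⟨Fin.cons head l, ?_, Fin.cases ⟨_, rfl⟩ hl'⟩
    exact congrArg (fun y : (Ty.list τ).sem ↦
      (cons (.app t v1) v0).sem (Ctx.cons y (Ctx.cons (v 0) d))) hl

theorem exists_sem_mapList {Γ : Ctx} {σ τ : Ty}
    (t : Tm (Ty.list τ :: σ :: Ty.list σ :: Γ) (Ty.fn σ τ)) (d : Γ.sem) (e : (Ty.list σ).sem) :
    ∃ l : Fin e.1 → τ.sem,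
      Hom.toFun ((lam (fold (.cons (.app t v1) v0) v0 .nil)).sem d) e = ⟨e.1, l⟩ ∧
        ∀ i, ∃ d', l i = Hom.toFun (t.sem d') (e.2 i) :=
  exists_foldAux_mapList t (Ctx.cons e d) e.1 e.2

variable {k : ℕ} {Γ : Ctx} (d : Γ.sem) (e : (Ty.real.D k).sem)

theorem sem_lamR_real :
    Hom.toFun ((lamR k .real trivial).sem d) e =
      (pair (v0.wkN k _) (.lam (.tuple fun i ↦ .mul (.var (.s (.bound k _ i))) v0))).sem
        (Ctx.extend (Ctx.cons (σ := .real) (e (0 : Fin 2)) (Ctx.cons (σ := .vec k) (e (1 : Fin 2))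
          (Ctx.cons e d))) k (fun _ ↦ Ty.real) (e (1 : Fin 2))) :=
  sem_letTuple (σ := fun _ ↦ Ty.real) (v1 (a := Ty.vec k) (b := Ty.real))
    (pair (v0.wkN k _) (.lam (.tuple fun i ↦ .mul (.var (.s (.bound k _ i))) v0)))
    (Ctx.cons (σ := .real) (e (0 : Fin 2)) (Ctx.cons (σ := .vec k) (e (1 : Fin 2)) (Ctx.cons e d)))

theorem primal_lamR : Ty.primal (Hom.toFun ((lamR k .real trivial).sem d) e) = e (0 : Fin 2) :=
  (congrArg Ty.primal (sem_lamR_real d e)).trans (sem_wkN v0 k _ _ _)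

theorem backprop_lamR (z : ℝ) (j : Fin k) :
    Ty.backprop (Hom.toFun ((lamR k .real trivial).sem d) e) z j =
      HMul.hMul (α := ℝ) (β := ℝ) ((e (1 : Fin 2) : (Ty.vec k).sem) j) z :=
  (congrArg (Ty.backprop · z j) (sem_lamR_real d e)).trans
    (congrArg (fun a : ℝ ↦ a * z) (Var.sem_bound_extend _ k _ _ j))

end Tm

theorem Represents.rel_lamR {k : ℕ} {J : Set (Fin k)} : ∀ (τ : Ty) (h : τ.FirstOrder) {Γ : Ctx}
    (d : Γ.sem) {γ : Hom DiffSp.real τ.sem} {e : (τ.D k).sem}, Represents J γ (τ.toTangent k h e) →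
      τ.Rel J γ (Hom.toFun ((Tm.lamR k τ h).sem d) e)
  | .real, _, _, d, γ, e, hr => by
    refine ⟨(Tm.primal_lamR d e).trans hr.1, fun j hj z ↦ ?_⟩
    have hj' := (tangentPowProj_tangentReal.1 (hr.2 j hj)).2
    exact (Tm.backprop_lamR d e z j).trans ((mul_comm _ _).trans (congrArg (z * ·) hj'))
  | .prod n σ, h, _, d, γ, e, hr => by
    have hd := Tm.sem_mapTuple (fun i ↦ Tm.lamR k (σ i) (h i)) d e
    exact (congrArg ((Ty.prod n σ).Rel J γ) hd).mpr fun i ↦ rel_lamR (σ i) (h i) _ (hr.proj i)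
  | .fn _ _, h, _, _, _, _, _ => h.elim
  | .variant _ σ, h, _, _, _, ⟨i, _⟩, hr => by
    obtain ⟨γ', hγ', hr'⟩ := hr.exists_inj
    exact ⟨γ', hγ', rel_lamR (σ i) (h i) _ hr'⟩
  | .list σ, h, _, d, γ, e, hr => by
    obtain ⟨l, hl, hl'⟩ := Tm.exists_sem_mapList (Tm.lamR k σ h) d e
    obtain ⟨γ', hγ', hr'⟩ := hr.exists_inj
    let δ (i : Fin e.1) : Hom DiffSp.real σ.sem := Hom.comp (Hom.piProj i) γ'
    have hδ (i : Fin e.1) : σ.Rel J (δ i) (l i) := by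
      obtain ⟨d', hd'⟩ := hl' i
      exact hd' ▸ rel_lamR σ h d' (hr'.proj i)
    exact (congrArg ((Ty.list σ).Rel J γ) hl).mpr ⟨δ, hγ', hδ⟩

theorem Ty.Rel.represents_evR {k : ℕ} {J : Set (Fin k)} : ∀ (τ : Ty) (h : τ.FirstOrder)
    {Γ : Ctx} (d : Γ.sem) {γ : Hom DiffSp.real τ.sem} {e : (τ.Drev k).sem}, τ.Rel J γ e →
      Represents J γ (τ.toTangent k h (Hom.toFun ((Tm.evR k τ h).sem d) e))
  | .real, _, _, _, _, _, hr =>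
    ⟨hr.1, fun j hj ↦ tangentPowProj_tangentReal.2
      ⟨hr.1, (hr.2 j hj 1).trans (one_mul _)⟩⟩
  | .prod n σ, h, _, d, γ, e, hr => by
    have hd := Tm.sem_mapTuple (fun i ↦ Tm.evR k (σ i) (h i)) d e
    exact (congrArg (fun v ↦ Represents J γ (Ty.toTangent k (.prod n σ) h v)) hd).mpr <|
      Represents.pi fun i ↦ represents_evR (σ i) (h i) _ (hr i)
  | .fn _ _, h, _, _, _, _, _ => h.elim
  | .variant _ σ, h, _, _, _, ⟨i, _⟩, ⟨_, hγ, hr⟩ =>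
    hγ ▸ (represents_evR (σ i) (h i) _ hr).map _
  | .list σ, h, _, d, γ, e, ⟨γ', hγ, hr⟩ => by
    obtain ⟨l, hl, hl'⟩ := Tm.exists_sem_mapList (Tm.evR k σ h) d e
    have hpi : Represents J (Hom.piLift γ') (tangentPi k fun i ↦ σ.toTangent k h (l i)) := by
      refine Represents.pi fun i ↦ ?_
      obtain ⟨d', hd'⟩ := hl' i
      exact hd' ▸ represents_evR σ h d' (hr i)
    have hinj := hpi.map (Hom.inj (X := fun m : ℕ ↦ DiffSp.pi fun _ : Fin m ↦ σ.sem) e.1)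
    exact (congrArg (fun v ↦ Represents J γ (Ty.toTangent k (.list σ) h v)) hl).mpr (hγ ▸ hinj)

theorem Sub.sem_wk {Γ Δ : Ctx} {σ : Ty} (θ : Sub Γ Δ) (a : σ.sem) (d : Δ.sem) :
    Sub.sem (fun _ x ↦ (θ x).wk : Sub Γ (σ :: Δ)) (Ctx.cons a d) = θ.sem d :=
  Ctx.sem_ext fun _ x ↦ (sem_var _ x _).trans ((Tm.sem_wk _ a d).trans (sem_var θ x d).symm)

theorem Represents.rel_lamR_ctx {k : ℕ} {J : Set (Fin k)} : ∀ (Γ : Ctx) (h : Γ.FirstOrder)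
    {γ : Hom DiffSp.real Γ.sem} {d : Ctx.sem (List.map (Ty.D k) Γ)},
      Represents J γ (Γ.toTangent k h d) → Ctx.Rel J Γ γ ((Sub.lamR k Γ h).sem d)
  | [], _, _, _, _ => trivial
  | σ :: Γ, _, γ, d, hr =>
    ⟨rel_lamR σ _ _ hr.fst, (congrArg (Ctx.Rel J Γ (Hom.comp Hom.snd γ))
      (Sub.sem_wk (Sub.lamR k Γ _) d.1 d.2)).mpr (rel_lamR_ctx Γ _ hr.snd)⟩

namespace Tm

variable {k : ℕ} {Γ : Ctx} {τ : Ty} (hΓ : Γ.FirstOrder) (hτ : τ.FirstOrder) (t : Tm Γ τ)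

theorem represents_revAD {J : Set (Fin k)} {γ : Hom DiffSp.real Γ.sem}
    {d : Ctx.sem (List.map (Ty.D k) Γ)} (h : Represents J γ (Γ.toTangent k hΓ d)) :
    Represents J (Hom.comp t.sem γ) (τ.toTangent k hτ ((t.revAD k hΓ hτ).sem d)) := by
  have hrel := t.rel (h.rel_lamR_ctx Γ hΓ)
  rw [← sem_subst] at hrel
  exact hrel.represents_evR τ hτ d

theorem toTangent_revAD (d : Ctx.sem (List.map (Ty.D k) Γ)) :
    τ.toTangent k hτ ((t.revAD k hΓ hτ).sem d) = tangentMap k t.sem (Γ.toTangent k hΓ d) := by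
  refine DiffSp.tangentPow_ext ?_ fun j ↦ ?_
  · have h : Represents ∅ (Hom.const (Γ.toTangent k hΓ d).1) (Γ.toTangent k hΓ d) :=
      ⟨rfl, fun _ hj ↦ hj.elim⟩
    exact (represents_revAD hΓ hτ t h).1
  · obtain ⟨γ, hγ⟩ := exists_curveTangent_eq (tangentPowProj j (Γ.toTangent k hΓ d))
    have h : Represents {j} γ (Γ.toTangent k hΓ d) :=
      ⟨(congrArg Sigma.fst hγ).symm, by rintro _ rfl; exact hγ.symm⟩
    exact ((represents_revAD hΓ hτ t h).2 j rfl).trans (congrArg (tangentBundleMap t.sem) hγ)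

end Tm

end RevAD

end

theorem theorem3 (k : ℕ) (Γ : RevAD.Ctx) (τ : RevAD.Ty) (hΓ : Γ.FirstOrder) (hτ : τ.FirstOrder)
    (t : RevAD.Tm Γ τ) :
    RevAD.IsDiffeo (Γ.toTangent k hΓ) ∧ RevAD.IsDiffeo (τ.toTangent k hτ) ∧
      ∀ d : RevAD.Ctx.sem (List.map (RevAD.Ty.D k) Γ),
        τ.toTangent k hτ ((t.revAD k hΓ hτ).sem d) =
          RevAD.tangentMap k t.sem (Γ.toTangent k hΓ d) :=
  ⟨Γ.isDiffeo_toTangent k hΓ, τ.isDiffeo_toTangent k hτ, t.toTangent_revAD hΓ hτ⟩
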